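/- Let $c>0$ and $k>\frac16$. For $\Omega\in\mathbb R$ consider the system for real profiles $(U,A)$ on $\mathbb R$ $$U''-cU+\tfrac12U^2+A^2=0,\qquad A''+(\Omega+kU)A=0, \tag{$*$}$$ which, with $A=0$, is solved by $U_0(\xi)=3c\,\mathrm{sech}^2\!\left(\tfrac{\sqrt c}{2}\xi\right)$. Put $$\widetilde\Omega_c=-\frac{c}{16}\left(\sqrt{1+48k}-3\right)^2,\qquad q=\frac{\sqrt{1+48k}-3}{2},\qquad \tilde g(\xi)=\mathrm{sech}^q\!\left(\tfrac{\sqrt c}{2}\xi\right)\tanh\!\left(\tfrac{\sqrt c}{2}\xi\right),$$ and $L_1=-\partial_\xi^2+c-U_0$. Then there is a unique even $W\in H^2(\mathbb R)$ with $L_1W=\tilde g^2$; denote it by $L_1^{-1}\tilde g^2$. Let $Q=\langle\tilde g^2,L_1^{-1}\tilde g^2\rangle=\int_{\mathbb R}\tilde g^2\,L_1^{-1}\tilde g^2\,d\xi$ and assume $Q\neq0$. Then there are constants $\delta,C,\varepsilon>0$ (depending only on $c$ and $k$) such that for every $\Omega$ with $|\Omega-\widetilde\Omega_c|<\delta$ and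 $\mathrm{sgn}(\Omega-\widetilde\Omega_c)=-\mathrm{sgn}(Q)$ the system $(*)$ has a solution $(U,A)\in H^2_{\rm even}(\mathbb R)\times H^2_{\rm odd}(\mathbb R)$ with $A\neq0$, $\|U-U_0\|_{H^2}<\varepsilon$, $\|A\|_{H^2}<\varepsilon$ and $$\|U-U_0\|_{H^2}\le C\,|\Omega-\widetilde\Omega_c|,\qquad \|A\|_{H^2}\le C\sqrt{|\Omega-\widetilde\Omega_c|},$$ and it is unique up to the symmetry $A\mapsto-A$: every solution $(V,B)\in H^2_{\rm even}(\mathbb R)\times H^2_{\rm odd}(\mathbb R)$ of $(*)$ with $B\ne0$, $\|V-U_0\|_{H^2}<\varepsilon$ and $\|B\|_{H^2}<\varepsilon$ is $(U,A)$ or $(U,-A)$. -/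

import Mathlib

open MeasureTheory

noncomputable section

namespace KdVLS

/-- `g` is a weak derivative of `f` on the real line. -/
def IsWeakDeriv (f g : ℝ → ℝ) : Prop :=
  LocallyIntegrable f volume ∧ LocallyIntegrable g volume ∧
    ∀ φ : ℝ → ℝ, ContDiff ℝ (⊤ : ℕ∞) φ → HasCompactSupport φ →
      ∫ x, f x * deriv φ x = -∫ x, g x * φ x

open Classical in
/-- A representative of the weak derivative of `f` (unique up to null sets);
the zero function if `f` has no weak derivative. -/
def weakDeriv (f : ℝ → ℝ) : ℝ → ℝ :=
  if h : ∃ g, IsWeakDeriv f g then h.choose else 0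

/-- `f` represents an element of the real Sobolev space `H²(ℝ)`: the function and its first two
weak derivatives are square integrable. -/
def MemH2 (f : ℝ → ℝ) : Prop :=
  ∃ f₁ f₂ : ℝ → ℝ, IsWeakDeriv f f₁ ∧ IsWeakDeriv f₁ f₂ ∧
    MemLp f 2 volume ∧ MemLp f₁ 2 volume ∧ MemLp f₂ 2 volume

/-- The norm of `H²(ℝ)`. -/
def h2Norm (f : ℝ → ℝ) : ℝ :=
  Real.sqrt ((∫ x, f x ^ 2) + (∫ x, weakDeriv f x ^ 2) + ∫ x, weakDeriv (weakDeriv f) x ^ 2)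

/-- The subspace of even functions in `H²(ℝ)`. -/
def MemH2Even (f : ℝ → ℝ) : Prop := MemH2 f ∧ ∀ᵐ x, f (-x) = f x

/-- The subspace of odd functions in `H²(ℝ)`. -/
def MemH2Odd (f : ℝ → ℝ) : Prop := MemH2 f ∧ ∀ᵐ x, f (-x) = -f x

/-- The system `U'' - c U + U² / 2 + s A² = 0`, `A'' + (Ω + k U) A = 0`, with the second
derivatives in the weak sense and the equations in the sense of `L²(ℝ)`. -/
def SolvesSystem (c k s Ω : ℝ) (U A : ℝ → ℝ) : Prop :=
  (∀ᵐ x, weakDeriv (weakDeriv U) x - c * U x + 1 / 2 * U x ^ 2 + s * A x ^ 2 = 0) ∧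
    ∀ᵐ x, weakDeriv (weakDeriv A) x + (Ω + k * U x) * A x = 0

def sech (x : ℝ) : ℝ := 1 / Real.cosh x

/-- The uncoupled KdV soliton `U₀`. -/
def soliton (c x : ℝ) : ℝ := 3 * c * sech (Real.sqrt c / 2 * x) ^ 2

/-- The operator `L₁ = -∂² + c - U₀`. -/
def opL1 (c : ℝ) (W : ℝ → ℝ) (x : ℝ) : ℝ :=
  -weakDeriv (weakDeriv W) x + c * W x - soliton c x * W x

/-- The exponent `q`. -/
def expQ (k : ℝ) : ℝ := (Real.sqrt (1 + 48 * k) - 3) / 2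

/-- The function `g̃ = sech^q tanh`, in the variable `√c x / 2`. -/
def gTilde (c k x : ℝ) : ℝ :=
  sech (Real.sqrt c / 2 * x) ^ expQ k * Real.tanh (Real.sqrt c / 2 * x)

/-- The second bifurcation point. -/
def omegaC (c k : ℝ) : ℝ := -(c / 16) * (Real.sqrt (1 + 48 * k) - 3) ^ 2

end KdVLS

end

/-!
Both linearisations at `(U₀, 0)`, `Ω = Ω̃_c`, are instances of one Pöschl–Teller operator
`-∂² + potential a q` with `a = √c / 2`: the first equation gives `L₁` with exponent `2`, the second
has exponent `expQ k`. Each has an explicit odd decaying solution `φ = sech^q (a x) tanh (a x)`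
(`decaySol`) and an even growing solution `ψ` (`growSol`) with constant Wronskian. Variation of
constants therefore inverts the operator on sources orthogonal to `φ` (`greenFn`), keeps every decay
rate `0 ≤ η < a q` (`exists_greenFn_bound`), and any bounded solution `u` with bounded derivative and
`u' 0 = 0` is the one it produces (`eq_greenFn_of_bounded`). For `L₁` the kernel `U₀'` is odd and the
sources are even, so orthogonality is automatic; for the second equation it is the bifurcation
condition.

Put `Ω = Ω̃_c + ω`, `U = U₀ + t w`, `A = √t (φ + h)` with `h' 0 = 0`. The system becomes
`L₁ w = t w² / 2 + (φ + h)²` and `L₂ h = (ω + k t w)(φ + h)` with `L₂ = -∂² + potential a (expQ k)`,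
together with the orthogonality of the
last right-hand side to `φ` (`IsProfile`). At `ω = 0` it is solved by `(w, h, t) = (W, 0, 0)` with
`W = L₁⁻¹ φ²` (`quadResponse`), and its linearisation there is triangular, the last diagonal entry
being `k Q`. As `Q ≠ 0`, the inverse function theorem gives, for each small `ω`, exactly one profile
near the base point (`bifMap_existsUnique`, `profile_existsUnique`), in the space of continuous
functions with any admissible decay rate `η`. The orthogonality condition reads
`ω (∫ φ² + …) + k t (Q + …) = 0`, so that `|t| = O(|ω|)`, and `t > 0` exactly on the side
`sgn ω = -sgn Q` (`exists_amplitude_bound`).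

The inverse function theorem is used twice. With `η > 0` the profile decays exponentially, hence lies
in `H²`, and yields the solution with its bounds (`exists_solution_of_profile`). With `η = 0` it
gives uniqueness among merely bounded profiles, and this is all that an arbitrary competitor needs to
satisfy: by the Sobolev embedding a solution that is `H²`-close to `(U₀, 0)` is a uniformly small
classical solution, and with `s = A' 0 / φ' 0` as scale the linear estimates give `s ≠ 0`,
`U - U₀ = O(s²)` and `A - s φ = o(s)`, so that it is a rescaled profile near `(W, 0, 0)` with
`t = s²` (`exists_profile_of_small`, `exists_profile_of_solution`). Uniqueness of `t` then leaves only
the sign of `s`.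
-/

namespace KdVLS

noncomputable section

open Real Set Filter Topology
open scoped BoundedContinuousFunction

/-! ### The Pöschl–Teller operator and its two explicit solutions -/

/-- The potential of the Pöschl–Teller operator `-∂² + potential a q`. With `a = √c / 2` this operator
is `L₁` for `q = 2` and `-∂² - Ω̃_c - k U₀` for `q = expQ k`. -/
def potential (a q x : ℝ) : ℝ := a ^ 2 * (q ^ 2 - (q + 1) * (q + 2) * sech (a * x) ^ 2)

/-- The odd, exponentially decaying solution `φ = sech^q (a x) tanh (a x)` of `u'' = potential a q u`. -/
def decaySol (a q x : ℝ) : ℝ := sech (a * x) ^ q * tanh (a * x)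

/-- The derivative of `decaySol`. -/
def decaySolDeriv (a q x : ℝ) : ℝ := a * sech (a * x) ^ q * ((q + 1) * sech (a * x) ^ 2 - q)

/-- The even solution `ψ` of `u'' = potential a q u`, with the growth rate `exp (a q |x|)`. It comes
from `decaySol` by reduction of order: two integrations by parts in `φ ∫ φ⁻²` remove the singularity
at the origin. -/
def growSol (a q x : ℝ) : ℝ :=
  -cosh (a * x) ^ q +
    (2 * q + 1) * decaySol a q x * ∫ s in (0 : ℝ)..x, a * cosh (a * s) ^ (2 * q)

/-- The derivative of `growSol`. -/
def growSolDeriv (a q x : ℝ) : ℝ :=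
  -(a * q * cosh (a * x) ^ q * tanh (a * x)) +
    (2 * q + 1) * (decaySolDeriv a q x * (∫ s in (0 : ℝ)..x, a * cosh (a * s) ^ (2 * q)) +
      decaySol a q x * (a * cosh (a * x) ^ (2 * q)))

lemma sech_pos (x : ℝ) : 0 < sech x := one_div_pos.2 (cosh_pos x)

lemma sech_le_one (x : ℝ) : sech x ≤ 1 := by
  unfold sech; rw [div_le_one (cosh_pos x)]; exact one_le_cosh x

lemma sech_neg (x : ℝ) : sech (-x) = sech x := by simp [sech]

lemma sech_rpow (x q : ℝ) : sech x ^ q = (cosh x ^ q)⁻¹ := by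
  rw [sech, one_div, inv_rpow (cosh_pos x).le]

lemma hasDerivAt_cosh_mul (a x : ℝ) : HasDerivAt (fun x => cosh (a * x)) (a * sinh (a * x)) x := by
  have h := (hasDerivAt_id x).const_mul a |>.cosh
  simp only [id, mul_one] at h
  rwa [mul_comm] at h

lemma hasDerivAt_sinh_mul (a x : ℝ) : HasDerivAt (fun x => sinh (a * x)) (a * cosh (a * x)) x := by
  have h := (hasDerivAt_id x).const_mul a |>.sinh
  simp only [id, mul_one] at h
  rwa [mul_comm] at h

lemma hasDerivAt_cosh_rpow (a q x : ℝ) :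
    HasDerivAt (fun x => cosh (a * x) ^ q) (a * q * cosh (a * x) ^ q * tanh (a * x)) x := by
  have h := (hasDerivAt_cosh_mul a x).rpow_const (p := q) (Or.inl (cosh_pos (a * x)).ne')
  refine h.congr_deriv ?_
  rw [rpow_sub_one (cosh_pos _).ne', tanh_eq_sinh_div_cosh]
  ring

lemma decaySol_eq (a q x : ℝ) : decaySol a q x = (cosh (a * x) ^ q)⁻¹ * (sinh (a * x) / cosh (a * x)) := by
  rw [decaySol, sech_rpow, tanh_eq_sinh_div_cosh]

lemma hasDerivAt_decaySol (a q x : ℝ) :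
    HasDerivAt (decaySol a q) (decaySolDeriv a q x) x := by
  have hC := (cosh_pos (a * x)).ne'
  have hP := (rpow_pos_of_pos (cosh_pos (a * x)) q).ne'
  have h := ((hasDerivAt_cosh_rpow a q x).inv hP).mul
    ((hasDerivAt_sinh_mul a x).div (hasDerivAt_cosh_mul a x) hC)
  have e : decaySol a q = (fun x => cosh (a * x) ^ q)⁻¹ *
      ((fun x => sinh (a * x)) / fun x => cosh (a * x)) := by
    funext x; exact decaySol_eq a q x
  rw [e]
  refine h.congr_deriv ?_
  simp only [decaySolDeriv, sech_rpow, tanh_eq_sinh_div_cosh, Pi.inv_apply, Pi.div_apply]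
  simp only [sech]
  field_simp
  linear_combination a * (q + 1) * (cosh_sq_sub_sinh_sq (a * x))

lemma hasDerivAt_sech_rpow (a q x : ℝ) :
    HasDerivAt (fun x => sech (a * x) ^ q) (-(a * q * sech (a * x) ^ q * tanh (a * x))) x := by
  have h := hasDerivAt_cosh_rpow a (-q) x
  have e : (fun x => sech (a * x) ^ q) = fun x => cosh (a * x) ^ (-q) := by
    funext y; rw [sech_rpow, rpow_neg (cosh_pos _).le]
  rw [e]
  refine h.congr_deriv ?_
  rw [sech_rpow, rpow_neg (cosh_pos _).le]; ring

lemma hasDerivAt_sech_sq (a x : ℝ) :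
    HasDerivAt (fun x => sech (a * x) ^ 2) (-(2 * a * sech (a * x) ^ 2 * tanh (a * x))) x := by
  have h := hasDerivAt_sech_rpow a 2 x
  simp only [rpow_ofNat] at h
  convert h using 1; ring

lemma hasDerivAt_decaySolDeriv (a q x : ℝ) :
    HasDerivAt (decaySolDeriv a q) (potential a q x * decaySol a q x) x := by
  have h := ((hasDerivAt_sech_rpow a q x).const_mul a).mul
    (((hasDerivAt_sech_sq a x).const_mul (q + 1)).sub_const q)
  refine h.congr_deriv ?_
  simp only [potential, decaySol]
  ring

lemma continuous_cosh_rpow (a q : ℝ) : Continuous fun x => cosh (a * x) ^ q :=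
  continuous_iff_continuousAt.2 fun x => (hasDerivAt_cosh_rpow a q x).continuousAt

lemma hasDerivAt_integral_of_continuous {f : ℝ → ℝ} (hf : Continuous f) (x : ℝ) :
    HasDerivAt (fun x => ∫ s in (0 : ℝ)..x, f s) (f x) x :=
  intervalIntegral.integral_hasDerivAt_right (hf.intervalIntegrable _ _)
    hf.aestronglyMeasurable.stronglyMeasurableAtFilter hf.continuousAt

lemma cosh_rpow_two_mul (a q x : ℝ) : cosh (a * x) ^ (2 * q) = (cosh (a * x) ^ q) ^ 2 := by
  rw [mul_comm 2 q, rpow_mul (cosh_pos _).le, rpow_two]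

lemma hasDerivAt_growSol (a q x : ℝ) : HasDerivAt (growSol a q) (growSolDeriv a q x) x := by
  have hI := hasDerivAt_integral_of_continuous ((continuous_cosh_rpow a (2 * q)).const_mul a) x
  have h := (hasDerivAt_cosh_rpow a q x).neg.add
    (((hasDerivAt_decaySol a q x).const_mul (2 * q + 1)).mul hI)
  refine h.congr_deriv ?_
  simp only [growSolDeriv]; ring

lemma hasDerivAt_tanh_mul (a x : ℝ) :
    HasDerivAt (fun x => tanh (a * x)) (a * sech (a * x) ^ 2) x := by
  have hC := (cosh_pos (a * x)).ne'
  have h := (hasDerivAt_sinh_mul a x).div (hasDerivAt_cosh_mul a x) hC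
  have e : (fun x => tanh (a * x)) = (fun x => sinh (a * x)) / fun x => cosh (a * x) := by
    funext x; exact tanh_eq_sinh_div_cosh _
  rw [e]
  refine h.congr_deriv ?_
  simp only [sech]
  field_simp
  linear_combination a * (cosh_sq_sub_sinh_sq (a * x))

lemma tanh_sq_eq (x : ℝ) : tanh x ^ 2 = 1 - sech x ^ 2 := by
  have hC := (cosh_pos x).ne'
  rw [tanh_eq_sinh_div_cosh, sech]
  field_simp
  linear_combination - (cosh_sq_sub_sinh_sq x)

lemma sech_rpow_mul_cosh_rpow (x q : ℝ) : sech x ^ q * cosh x ^ q = 1 := by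
  rw [sech_rpow, inv_mul_cancel₀ (rpow_pos_of_pos (cosh_pos x) q).ne']

lemma hasDerivAt_growSolDeriv (a q x : ℝ) :
    HasDerivAt (growSolDeriv a q) (potential a q x * growSol a q x) x := by
  have hI := hasDerivAt_integral_of_continuous ((continuous_cosh_rpow a (2 * q)).const_mul a) x
  have h := (((hasDerivAt_cosh_rpow a q x).const_mul (a * q)).mul (hasDerivAt_tanh_mul a x)).neg.add
    ((((hasDerivAt_decaySolDeriv a q x).mul hI).add ((hasDerivAt_decaySol a q x).mul
      ((hasDerivAt_cosh_rpow a (2 * q) x).const_mul a))).const_mul (2 * q + 1))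
  refine h.congr_deriv ?_
  simp only [growSol, decaySolDeriv, decaySol, potential, cosh_rpow_two_mul]
  -- after these abbreviations only `sech^q * cosh^q = 1` and `tanh² = 1 - sech²` are needed
  set I := ∫ s in (0 : ℝ)..x, a * (cosh (a * s) ^ q) ^ 2
  have hPQ := sech_rpow_mul_cosh_rpow (a * x) q
  have hT := tanh_sq_eq (a * x)
  set P := cosh (a * x) ^ q
  set Q := sech (a * x) ^ q
  set T := tanh (a * x)
  set s := sech (a * x)
  have h2 : Q * P ^ 2 = P := by rw [pow_two, ← mul_assoc, hPQ, one_mul]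
  linear_combination (-P * a ^ 2 * q ^ 2 + a ^ 2 * 2 * q * (2 * q + 1) * P) * hT +
    ((2 * q + 1) * a ^ 2 * 2 * ((q + 1) * s ^ 2 - q) + 2 * q * a ^ 2 * (2 * q + 1) * T ^ 2) * h2

/-- The Wronskian of the two solutions is constant. -/
lemma wronskian_decaySol_growSol (a q x : ℝ) :
    decaySol a q x * growSolDeriv a q x - decaySolDeriv a q x * growSol a q x = a := by
  simp only [growSol, growSolDeriv, decaySolDeriv, decaySol, cosh_rpow_two_mul]
  set I := ∫ s in (0 : ℝ)..x, a * (cosh (a * s) ^ q) ^ 2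
  have hPQ := sech_rpow_mul_cosh_rpow (a * x) q
  have hT := tanh_sq_eq (a * x)
  set P := cosh (a * x) ^ q
  set Q := sech (a * x) ^ q
  set T := tanh (a * x)
  set s := sech (a * x)
  linear_combination (-a*q*T^2 + a*((q+1)*s^2-q) + (2*q+1)*a*T^2*(Q*P+1)) * hPQ + a * (q+1) * hT

lemma continuous_decaySol (a q : ℝ) : Continuous (decaySol a q) :=
  continuous_iff_continuousAt.2 fun x => (hasDerivAt_decaySol a q x).continuousAt

lemma continuous_growSol (a q : ℝ) : Continuous (growSol a q) :=
  continuous_iff_continuousAt.2 fun x => (hasDerivAt_growSol a q x).continuousAt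

lemma decaySol_neg (a q x : ℝ) : decaySol a q (-x) = -decaySol a q x := by
  simp [decaySol, sech_neg]

lemma decaySolDeriv_neg (a q x : ℝ) : decaySolDeriv a q (-x) = decaySolDeriv a q x := by
  simp [decaySolDeriv, sech_neg]

lemma intervalIntegral_zero_neg (f : ℝ → ℝ) (x : ℝ) :
    ∫ s in (0 : ℝ)..-x, f s = -∫ s in (0 : ℝ)..x, f (-s) := by
  rw [intervalIntegral.integral_comp_neg, neg_zero, intervalIntegral.integral_symm]

lemma growSol_neg (a q x : ℝ) : growSol a q (-x) = growSol a q x := by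
  simp [growSol, decaySol_neg, intervalIntegral_zero_neg]

lemma growSolDeriv_neg (a q x : ℝ) : growSolDeriv a q (-x) = -growSolDeriv a q x := by
  simp [growSolDeriv, decaySol_neg, decaySolDeriv_neg, intervalIntegral_zero_neg]; ring

lemma decaySol_zero (a q : ℝ) : decaySol a q 0 = 0 := by simp [decaySol]

lemma decaySolDeriv_zero (a q : ℝ) : decaySolDeriv a q 0 = a := by
  simp [decaySolDeriv, sech]

lemma growSolDeriv_zero (a q : ℝ) : growSolDeriv a q 0 = 0 := by
  simp [growSolDeriv, decaySol]

lemma cosh_rpow_le {q y : ℝ} (hq : 0 ≤ q) (hy : 0 ≤ y) : cosh y ^ q ≤ exp (q * y) := by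
  have h : cosh y ≤ exp y := by
    rw [cosh_eq]; linarith [exp_le_exp.2 (by linarith : -y ≤ y)]
  calc cosh y ^ q ≤ exp y ^ q := rpow_le_rpow (cosh_pos y).le h hq
    _ = exp (q * y) := by rw [← exp_mul, mul_comm]

lemma sech_rpow_le {q : ℝ} (hq : 0 ≤ q) (y : ℝ) : sech y ^ q ≤ 2 ^ q * exp (-(q * |y|)) := by
  have h : sech y ≤ 2 * exp (-|y|) := by
    have h1 : exp |y| ≤ 2 * cosh y := by
      rw [← cosh_abs, cosh_eq]; linarith [exp_pos (-|y|)]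
    rw [sech, div_le_iff₀ (cosh_pos y), exp_neg]
    have := exp_pos |y|
    field_simp
    linarith
  calc sech y ^ q ≤ (2 * exp (-|y|)) ^ q := rpow_le_rpow (sech_pos y).le h hq
    _ = _ := by rw [mul_rpow (by norm_num) (exp_pos _).le, ← exp_mul]; ring_nf

lemma abs_tanh_le_one (y : ℝ) : |tanh y| ≤ 1 := by
  rw [← sq_le_one_iff_abs_le_one, tanh_sq_eq]; nlinarith [sech_pos y]

lemma abs_decaySol_le {a q : ℝ} (ha : 0 < a) (hq : 0 < q) (x : ℝ) :
    |decaySol a q x| ≤ 2 ^ q * exp (-(a * q * |x|)) := by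
  have h := sech_rpow_le hq.le (a * x)
  rw [abs_mul, abs_of_pos ha] at h
  rw [decaySol, abs_mul, abs_of_pos (rpow_pos_of_pos (sech_pos _) q)]
  calc _ ≤ sech (a * x) ^ q * 1 := by
        gcongr
        · exact (rpow_pos_of_pos (sech_pos _) q).le
        · exact abs_tanh_le_one _
    _ ≤ _ := by rw [mul_one]; convert h using 3; ring

lemma abs_decaySolDeriv_le {a q : ℝ} (ha : 0 < a) (hq : 0 < q) (x : ℝ) :
    |decaySolDeriv a q x| ≤ a * (q + 1) * 2 ^ q * exp (-(a * q * |x|)) := by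
  have h := sech_rpow_le hq.le (a * x)
  rw [abs_mul, abs_of_pos ha] at h
  have h0 := (rpow_pos_of_pos (sech_pos (a * x)) q)
  rw [decaySolDeriv, abs_mul, abs_mul, abs_of_pos h0, abs_of_pos ha]
  have h1 : |(q + 1) * sech (a * x) ^ 2 - q| ≤ q + 1 := by
    have := sech_pos (a * x); have := sech_le_one (a * x)
    have h2 : sech (a * x) ^ 2 ≤ 1 := by nlinarith
    rw [abs_le]; constructor <;> nlinarith [sq_nonneg (sech (a * x))]
  calc _ ≤ a * (2 ^ q * exp (-(q * (a * |x|)))) * (q + 1) := by gcongr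
    _ = _ := by ring_nf

/-- Exponential bounds for both solutions and their derivatives on the half line. -/
lemma exists_bound_solutions {a q : ℝ} (ha : 0 < a) (hq : 0 < q) :
    ∃ D > 0, ∀ x, 0 ≤ x →
      |decaySol a q x| ≤ D * exp (-(a * q * x)) ∧ |decaySolDeriv a q x| ≤ D * exp (-(a * q * x)) ∧
      |growSol a q x| ≤ D * exp (a * q * x) ∧ |growSolDeriv a q x| ≤ D * exp (a * q * x) := by
  set B := (2 : ℝ) ^ q with hB
  have hBp : 0 < B := rpow_pos_of_pos two_pos q
  have key : ∀ x, 0 ≤ x → |∫ s in (0 : ℝ)..x, a * cosh (a * s) ^ (2 * q)| ≤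
      exp (2 * (a * q * x)) / (2 * q) := by
    intro x hx
    have h1 : ∫ s in (0 : ℝ)..x, a * exp (2 * (a * q * s)) = (exp (2 * (a * q * x)) - 1) / (2 * q) := by
      have : ∀ s ∈ uIcc 0 x, HasDerivAt (fun s => exp (2 * (a * q * s)) / (2 * q))
          (a * exp (2 * (a * q * s))) s := by
        intro s _
        have h := ((((hasDerivAt_id s).const_mul (a * q)).const_mul 2).exp).div_const (2 * q)
        refine h.congr_deriv ?_
        simp only [id]; field_simp
      rw [intervalIntegral.integral_eq_sub_of_hasDerivAt this
        (Continuous.intervalIntegrable (by fun_prop) _ _)]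
      simp; ring
    have hnn : ∀ s, 0 ≤ a * cosh (a * s) ^ (2 * q) := fun s =>
      mul_nonneg ha.le (rpow_pos_of_pos (cosh_pos _) _).le
    rw [abs_of_nonneg (intervalIntegral.integral_nonneg hx fun s _ => hnn s)]
    calc _ ≤ ∫ s in (0 : ℝ)..x, a * exp (2 * (a * q * s)) := by
          apply intervalIntegral.integral_mono_on hx
            (((continuous_cosh_rpow a (2 * q)).const_mul a).intervalIntegrable _ _)
            (Continuous.intervalIntegrable (by fun_prop) _ _)
          intro s hs
          have := cosh_rpow_le (q := 2 * q) (y := a * s) (by positivity) (mul_nonneg ha.le hs.1)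
          gcongr
          refine this.trans (le_of_eq ?_)
          ring_nf
      _ ≤ _ := by rw [h1]; gcongr; linarith
  have hcosh : ∀ x, 0 ≤ x → cosh (a * x) ^ q ≤ exp (a * q * x) := by
    intro x hx
    have := cosh_rpow_le hq.le (mul_nonneg ha.le hx)
    refine this.trans (le_of_eq ?_)
    ring_nf
  refine ⟨B + a * (q + 1) * B + (1 + (2 * q + 1) * B / (2 * q)) +
    (a * q + (2 * q + 1) * (a * (q + 1) * B / (2 * q) + B * a)), by positivity, fun x hx => ?_⟩
  have f1 := abs_decaySol_le ha hq x
  have f2 := abs_decaySolDeriv_le ha hq x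
  rw [abs_of_nonneg hx, ← hB] at f1 f2
  set E := exp (a * q * x) with hE
  have hEp : 0 < E := exp_pos _
  have hEn : exp (-(a * q * x)) = E⁻¹ := exp_neg _
  rw [hEn] at f1 f2 ⊢
  have hE2 : exp (2 * (a * q * x)) = E ^ 2 := by rw [hE, ← exp_nat_mul]; simp
  have k := key x hx
  rw [hE2] at k
  have hc := hcosh x hx
  have hc0 := rpow_pos_of_pos (cosh_pos (a * x)) q
  have f3 : |growSol a q x| ≤ (1 + (2 * q + 1) * B / (2 * q)) * E := by
    rw [growSol]
    refine (abs_add_le _ _).trans ?_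
    rw [abs_neg, abs_of_pos hc0, abs_mul, abs_mul, abs_of_pos (by positivity : 0 < 2 * q + 1)]
    calc _ ≤ E + (2 * q + 1) * (B * E⁻¹) * (E ^ 2 / (2 * q)) := by gcongr
      _ = _ := by field_simp
  have f4 : |growSolDeriv a q x| ≤
      (a * q + (2 * q + 1) * (a * (q + 1) * B / (2 * q) + B * a)) * E := by
    rw [growSolDeriv, cosh_rpow_two_mul]
    refine (abs_add_le _ _).trans ?_
    rw [abs_neg, abs_mul, abs_of_pos (by positivity : 0 < a * q * cosh (a * x) ^ q), abs_mul,
      abs_of_pos (by positivity : 0 < 2 * q + 1)]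
    have g := abs_add_le (decaySolDeriv a q x * (∫ s in (0 : ℝ)..x, a * cosh (a * s) ^ (2 * q)))
      (decaySol a q x * (a * (cosh (a * x) ^ q) ^ 2))
    rw [abs_mul, abs_mul (decaySol a q x),
      abs_of_pos (by positivity : 0 < a * (cosh (a * x) ^ q) ^ 2)] at g
    calc _ ≤ a * q * E * 1 + (2 * q + 1) * ((a * (q + 1) * B * E⁻¹) * (E ^ 2 / (2 * q)) +
            B * E⁻¹ * (a * E ^ 2)) := by
          refine add_le_add ?_ (mul_le_mul_of_nonneg_left (g.trans ?_) (by positivity))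
          · gcongr; exact abs_tanh_le_one _
          · gcongr
      _ = _ := by field_simp
  have p1 : 0 < a * (q + 1) * B := by positivity
  have p2 : 0 < (1 + (2 * q + 1) * B / (2 * q)) := by positivity
  have p3 : 0 < (a * q + (2 * q + 1) * (a * (q + 1) * B / (2 * q) + B * a)) := by positivity
  refine ⟨f1.trans ?_, f2.trans ?_, f3.trans ?_, f4.trans ?_⟩ <;>
    refine mul_le_mul_of_nonneg_right ?_ (by positivity) <;> linarith

/-! ### The Green operator -/

/-- Variation of constants: for bounded `f` orthogonal to the decaying solution `φ` this is the bounded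
solution `u` of `-u'' + potential a q u = f` with `u' 0 = 0`. The last factor is
`∫ y in Ioi x, φ y * f y`, split at the origin so that it is differentiable for every continuous `f`. -/
def greenFn (a q : ℝ) (f : ℝ → ℝ) (x : ℝ) : ℝ :=
  a⁻¹ * (decaySol a q x * (∫ y in (0 : ℝ)..x, growSol a q y * f y) +
    growSol a q x * ((∫ y in Ioi (0 : ℝ), decaySol a q y * f y) -
      ∫ y in (0 : ℝ)..x, decaySol a q y * f y))

/-- The derivative of `greenFn a q f`. -/
def greenFnDeriv (a q : ℝ) (f : ℝ → ℝ) (x : ℝ) : ℝ :=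
  a⁻¹ * (decaySolDeriv a q x * (∫ y in (0 : ℝ)..x, growSol a q y * f y) +
    growSolDeriv a q x * ((∫ y in Ioi (0 : ℝ), decaySol a q y * f y) -
      ∫ y in (0 : ℝ)..x, decaySol a q y * f y))

lemma hasDerivAt_greenFn (a q : ℝ) {f : ℝ → ℝ} (hf : Continuous f) (x : ℝ) :
    HasDerivAt (greenFn a q f) (greenFnDeriv a q f x) x := by
  have hI := hasDerivAt_integral_of_continuous ((continuous_growSol a q).mul hf) x
  have hJ := (hasDerivAt_integral_of_continuous ((continuous_decaySol a q).mul hf) x).const_sub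
    (∫ y in Ioi (0 : ℝ), decaySol a q y * f y)
  have h := (((hasDerivAt_decaySol a q x).mul hI).add
    ((hasDerivAt_growSol a q x).mul hJ)).const_mul a⁻¹
  refine h.congr_deriv ?_
  simp only [greenFnDeriv, Pi.mul_apply]; ring

lemma hasDerivAt_greenFnDeriv {a : ℝ} (ha : a ≠ 0) (q : ℝ) {f : ℝ → ℝ} (hf : Continuous f) (x : ℝ) :
    HasDerivAt (greenFnDeriv a q f) (potential a q x * greenFn a q f x - f x) x := by
  have hI := hasDerivAt_integral_of_continuous ((continuous_growSol a q).mul hf) x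
  have hJ := (hasDerivAt_integral_of_continuous ((continuous_decaySol a q).mul hf) x).const_sub
    (∫ y in Ioi (0 : ℝ), decaySol a q y * f y)
  have h := (((hasDerivAt_decaySolDeriv a q x).mul hI).add
    ((hasDerivAt_growSolDeriv a q x).mul hJ)).const_mul a⁻¹
  refine h.congr_deriv ?_
  have hW := wronskian_decaySol_growSol a q x
  simp only [greenFn, Pi.mul_apply]
  field_simp
  linear_combination (- f x) * hW

lemma greenFnDeriv_zero (a q : ℝ) (f : ℝ → ℝ) : greenFnDeriv a q f 0 = 0 := by
  simp [greenFnDeriv, growSolDeriv_zero]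

lemma continuous_greenFn (a q : ℝ) {f : ℝ → ℝ} (hf : Continuous f) : Continuous (greenFn a q f) :=
  continuous_iff_continuousAt.2 fun x => (hasDerivAt_greenFn a q hf x).continuousAt

lemma integrable_exp_neg_mul_abs {m : ℝ} (hm : 0 < m) : Integrable fun x : ℝ => exp (-(m * |x|)) := by
  rw [← integrableOn_univ, ← Iic_union_Ioi (a := (0 : ℝ))]
  refine IntegrableOn.union ?_ ?_
  · refine (integrableOn_exp_mul_Iic hm 0).congr_fun (fun x hx => ?_) measurableSet_Iic
    simp [abs_of_nonpos (mem_Iic.1 hx)]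
  · refine (integrableOn_exp_mul_Ioi (neg_neg_iff_pos.2 hm) 0).congr_fun (fun x hx => ?_)
      measurableSet_Ioi
    simp [abs_of_pos (mem_Ioi.1 hx)]

lemma integrable_of_abs_le_exp {m M : ℝ} (hm : 0 < m) {f : ℝ → ℝ} (hf : Continuous f)
    (h : ∀ x, |f x| ≤ M * exp (-(m * |x|))) : Integrable f :=
  ((integrable_exp_neg_mul_abs hm).const_mul M).mono' hf.aestronglyMeasurable
    (Eventually.of_forall h)

lemma integrable_decaySol_mul {a q M : ℝ} (ha : 0 < a) (hq : 0 < q) {f : ℝ → ℝ} (hf : Continuous f)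
    (h : ∀ x, |f x| ≤ M) : Integrable fun x => decaySol a q x * f x := by
  refine integrable_of_abs_le_exp (m := a * q) (M := 2 ^ q * M) (by positivity)
    ((continuous_decaySol a q).mul hf) fun x => ?_
  rw [abs_mul]
  calc _ ≤ (2 ^ q * exp (-(a * q * |x|))) * M :=
        mul_le_mul (abs_decaySol_le ha hq x) (h x) (abs_nonneg _) (by positivity)
    _ = _ := by ring

/-- The orthogonality of `f` to the decaying solution makes the two half-line formulas match. -/
lemma integral_Ioi_decaySol_comp_neg {a q M : ℝ} (ha : 0 < a) (hq : 0 < q) {f : ℝ → ℝ}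
    (hf : Continuous f) (h : ∀ x, |f x| ≤ M) (h0 : ∫ x, decaySol a q x * f x = 0) :
    ∫ y in Ioi (0 : ℝ), decaySol a q y * f (-y) = ∫ y in Ioi (0 : ℝ), decaySol a q y * f y := by
  have hint := integrable_decaySol_mul ha hq hf h
  have h1 : ∫ y in Ioi (0 : ℝ), decaySol a q y * f (-y) =
      -∫ y in Iic (0 : ℝ), decaySol a q y * f y := by
    have := integral_comp_neg_Ioi (0 : ℝ) (fun y => decaySol a q y * f y)
    rw [neg_zero] at this
    rw [← this, ← integral_neg]
    simp [decaySol_neg]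
  have h2 := intervalIntegral.integral_Iic_add_Ioi (b := (0 : ℝ)) hint.integrableOn hint.integrableOn
  rw [h0] at h2
  linarith

lemma greenFn_neg {a q M : ℝ} (ha : 0 < a) (hq : 0 < q) {f : ℝ → ℝ} (hf : Continuous f)
    (h : ∀ x, |f x| ≤ M) (h0 : ∫ x, decaySol a q x * f x = 0) (x : ℝ) :
    greenFn a q f (-x) = greenFn a q (fun y => f (-y)) x := by
  simp only [greenFn, intervalIntegral_zero_neg, growSol_neg, decaySol_neg,
    integral_Ioi_decaySol_comp_neg ha hq hf h h0, neg_mul, intervalIntegral.integral_neg]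
  ring

lemma greenFnDeriv_neg {a q M : ℝ} (ha : 0 < a) (hq : 0 < q) {f : ℝ → ℝ} (hf : Continuous f)
    (h : ∀ x, |f x| ≤ M) (h0 : ∫ x, decaySol a q x * f x = 0) (x : ℝ) :
    greenFnDeriv a q f (-x) = -greenFnDeriv a q (fun y => f (-y)) x := by
  simp only [greenFnDeriv, intervalIntegral_zero_neg, growSol_neg, decaySol_neg, growSolDeriv_neg,
    decaySolDeriv_neg, integral_Ioi_decaySol_comp_neg ha hq hf h h0, neg_mul,
    intervalIntegral.integral_neg]
  ring

/-- The Green operator preserves the decay rate `exp (-η |x|)` for every `η` below `a q`. -/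
lemma exists_greenFn_bound {a q η : ℝ} (ha : 0 < a) (hq : 0 < q) (hη : 0 ≤ η) (hηq : η < a * q) :
    ∃ C > 0, ∀ (f : ℝ → ℝ) (M : ℝ), Continuous f → (∀ x, |f x| ≤ M * exp (-(η * |x|))) →
      ∫ x, decaySol a q x * f x = 0 → ∀ x,
        |greenFn a q f x| ≤ C * M * exp (-(η * |x|)) ∧
        |greenFnDeriv a q f x| ≤ C * M * exp (-(η * |x|)) := by
  obtain ⟨D, hD, hbd⟩ := exists_bound_solutions ha hq
  set m := a * q with hm
  have hmp : 0 < m := by positivity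
  have hmη : 0 < m - η := sub_pos.2 hηq
  have hmη' : 0 < m + η := by positivity
  -- on the half line `0 ≤ x` no orthogonality is needed
  have half : ∀ (f : ℝ → ℝ) (M : ℝ), Continuous f → (∀ x, |f x| ≤ M * exp (-(η * |x|))) →
      ∀ x, 0 ≤ x →
        |greenFn a q f x| ≤ a⁻¹ * (D * (D / (m - η)) + D * (D / (m + η))) * M * exp (-(η * x)) ∧
        |greenFnDeriv a q f x| ≤
          a⁻¹ * (D * (D / (m - η)) + D * (D / (m + η))) * M * exp (-(η * x)) := by
    intro f M hf hfM x hx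
    have hM : 0 ≤ M := by simpa using (abs_nonneg _).trans (hfM 0)
    have hfM' : ∀ y, |f y| ≤ M := fun y => (hfM y).trans (mul_le_of_le_one_right hM
      (exp_le_one_iff.2 (neg_nonpos.2 (by positivity))))
    have hI : |∫ y in (0 : ℝ)..x, growSol a q y * f y| ≤ D * M * exp ((m - η) * x) / (m - η) := by
      have h1 : ∫ y in (0 : ℝ)..x, D * M * exp ((m - η) * y) =
          D * M * exp ((m - η) * x) / (m - η) - D * M / (m - η) := by
        have : ∀ y ∈ uIcc 0 x, HasDerivAt (fun y => D * M * exp ((m - η) * y) / (m - η))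
            (D * M * exp ((m - η) * y)) y := by
          intro y _
          have h := (((((hasDerivAt_id y).const_mul (m - η)).exp).const_mul (D * M)).div_const
            (m - η))
          refine h.congr_deriv ?_
          simp only [id]; field_simp
        rw [intervalIntegral.integral_eq_sub_of_hasDerivAt this
          (Continuous.intervalIntegrable (by fun_prop) _ _)]
        simp
      have h2 := intervalIntegral.norm_integral_le_of_norm_le (μ := volume) hx
        (f := fun y => growSol a q y * f y) (g := fun y => D * M * exp ((m - η) * y))
        (Eventually.of_forall fun y hy => by
          rw [norm_eq_abs, abs_mul]
          have := hfM y
          rw [abs_of_pos hy.1] at this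
          calc _ ≤ (D * exp (m * y)) * (M * exp (-(η * y))) :=
                mul_le_mul (hbd y hy.1.le).2.2.1 this (abs_nonneg _) (by positivity)
            _ = _ := by rw [sub_mul, sub_eq_add_neg, exp_add]; ring)
        (Continuous.intervalIntegrable (by fun_prop) _ _)
      rw [h1, norm_eq_abs] at h2
      have : 0 ≤ D * M / (m - η) := by positivity
      linarith
    have hJ : |(∫ y in Ioi (0 : ℝ), decaySol a q y * f y) - ∫ y in (0 : ℝ)..x, decaySol a q y * f y|
        ≤ D * M * exp (-((m + η) * x)) / (m + η) := by
      have hint := integrable_decaySol_mul ha hq hf hfM'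
      have h1 := intervalIntegral.integral_interval_add_Ioi (a := (0 : ℝ)) (b := x)
        hint.integrableOn hint.integrableOn
      rw [← h1, add_sub_cancel_left]
      have h2 : ∫ y in Ioi x, D * M * exp (-(m + η) * y) = D * M * exp (-((m + η) * x)) / (m + η) := by
        rw [integral_const_mul, integral_exp_mul_Ioi (neg_neg_iff_pos.2 hmη')]
        rw [neg_div_neg_eq, neg_mul]; ring
      rw [← h2, ← norm_eq_abs]
      refine norm_integral_le_of_norm_le
        ((integrableOn_exp_mul_Ioi (neg_neg_iff_pos.2 hmη') x).const_mul _) ?_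
      refine (ae_restrict_iff' measurableSet_Ioi).2 (Eventually.of_forall fun y hy => ?_)
      have hy0 : 0 ≤ y := hx.trans (mem_Ioi.1 hy).le
      rw [norm_eq_abs, abs_mul]
      have := hfM y
      rw [abs_of_nonneg hy0] at this
      calc _ ≤ (D * exp (-(m * y))) * (M * exp (-(η * y))) :=
            mul_le_mul (hbd y hy0).1 this (abs_nonneg _) (by positivity)
        _ = _ := by rw [neg_mul, add_mul, neg_add, exp_add]; ring
    have comb : ∀ p g : ℝ, |p| ≤ D * exp (-(m * x)) → |g| ≤ D * exp (m * x) →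
        |a⁻¹ * (p * (∫ y in (0 : ℝ)..x, growSol a q y * f y) +
          g * ((∫ y in Ioi (0 : ℝ), decaySol a q y * f y) -
            ∫ y in (0 : ℝ)..x, decaySol a q y * f y))| ≤
          a⁻¹ * (D * (D / (m - η)) + D * (D / (m + η))) * M * exp (-(η * x)) := by
      intro p g hp hg
      rw [abs_mul, abs_of_pos (inv_pos.2 ha)]
      have e1 : exp (-(m * x)) * exp ((m - η) * x) = exp (-(η * x)) := by
        rw [← exp_add]; ring_nf
      have e2 : exp (m * x) * exp (-((m + η) * x)) = exp (-(η * x)) := by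
        rw [← exp_add]; ring_nf
      calc _ ≤ a⁻¹ * ((D * exp (-(m * x))) * (D * M * exp ((m - η) * x) / (m - η)) +
            (D * exp (m * x)) * (D * M * exp (-((m + η) * x)) / (m + η))) := by
            refine mul_le_mul_of_nonneg_left ((abs_add_le _ _).trans ?_) (inv_pos.2 ha).le
            rw [abs_mul, abs_mul g]
            gcongr
        _ = a⁻¹ * (D * (D / (m - η)) * M * (exp (-(m * x)) * exp ((m - η) * x)) +
            D * (D / (m + η)) * M * (exp (m * x) * exp (-((m + η) * x)))) := by ring
        _ = _ := by rw [e1, e2]; ring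
    exact ⟨comb _ _ (hbd x hx).1 (hbd x hx).2.2.1, comb _ _ (hbd x hx).2.1 (hbd x hx).2.2.2⟩
  refine ⟨a⁻¹ * (D * (D / (m - η)) + D * (D / (m + η))), by positivity, fun f M hf hfM h0 x => ?_⟩
  have hM : 0 ≤ M := by simpa using (abs_nonneg _).trans (hfM 0)
  have hfM' : ∀ y, |f y| ≤ M := fun y => (hfM y).trans (mul_le_of_le_one_right hM
      (exp_le_one_iff.2 (neg_nonpos.2 (by positivity))))
  rcases le_total 0 x with hx | hx
  · rw [abs_of_nonneg hx]; exact half f M hf hfM x hx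
  · have := half (fun y => f (-y)) M (hf.comp continuous_neg) (fun y => by simpa using hfM (-y)) (-x)
      (neg_nonneg.2 hx)
    rw [← greenFn_neg ha hq hf hfM' h0, neg_neg] at this
    rw [abs_of_nonpos hx]
    refine ⟨this.1, ?_⟩
    have h2 := greenFnDeriv_neg ha hq hf hfM' h0 (-x)
    rw [neg_neg] at h2
    rw [h2, abs_neg]; exact this.2

/-- A bounded solution of `-u'' + potential a q u = f` with bounded derivative forces `f` to be orthogonal
to the decaying solution, and the condition `u' 0 = 0` identifies it with `greenFn a q f`. Both come from
the Wronskians of `u` with the two explicit solutions. -/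
lemma eq_greenFn_of_bounded {a q N M : ℝ} (ha : 0 < a) (hq : 0 < q) {f u u₁ : ℝ → ℝ}
    (hf : Continuous f) (hfM : ∀ x, |f x| ≤ M) (hu : ∀ x, HasDerivAt u (u₁ x) x)
    (hu₁ : ∀ x, HasDerivAt u₁ (potential a q x * u x - f x) x) (hN : ∀ x, |u x| ≤ N)
    (hN₁ : ∀ x, |u₁ x| ≤ N) (h0 : u₁ 0 = 0) :
    ∫ x, decaySol a q x * f x = 0 ∧ ∀ x, u x = greenFn a q f x := by
  have hmp : 0 < a * q := by positivity
  have hint := integrable_decaySol_mul ha hq hf hfM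
  -- the Wronskian with the decaying solution
  set w : ℝ → ℝ := fun x => decaySolDeriv a q x * u x - decaySol a q x * u₁ x with hw
  have hwd : ∀ x, HasDerivAt w (decaySol a q x * f x) x := fun x => by
    refine (((hasDerivAt_decaySolDeriv a q x).mul (hu x)).sub
      ((hasDerivAt_decaySol a q x).mul (hu₁ x))).congr_deriv ?_
    ring
  have hwc : Continuous w := continuous_iff_continuousAt.2 fun x => (hwd x).continuousAt
  have hwint : Integrable w := by
    refine integrable_of_abs_le_exp (m := a * q)
      (M := a * (q + 1) * 2 ^ q * N + 2 ^ q * N) hmp hwc fun x => ?_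
    have hN0 : 0 ≤ N := (abs_nonneg _).trans (hN 0)
    calc |w x| ≤ |decaySolDeriv a q x| * |u x| + |decaySol a q x| * |u₁ x| := by
          rw [← abs_mul, ← abs_mul]; exact abs_sub _ _
      _ ≤ (a * (q + 1) * 2 ^ q * exp (-(a * q * |x|))) * N + (2 ^ q * exp (-(a * q * |x|))) * N := by
          gcongr
          · exact abs_decaySolDeriv_le ha hq x
          · exact hN x
          · exact abs_decaySol_le ha hq x
          · exact hN₁ x
      _ = _ := by ring
  refine ⟨integral_eq_zero_of_hasDerivAt_of_integrable hwd hint hwint, fun x => ?_⟩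
  have htop : Tendsto w atTop (𝓝 0) := tendsto_zero_of_hasDerivAt_of_integrableOn_Ioi (a := 0)
    (fun x _ => hwd x) hint.integrableOn hwint.integrableOn
  have h1 := integral_Ioi_of_hasDerivAt_of_tendsto' (a := 0) (fun x _ => hwd x) hint.integrableOn htop
  have h2 := intervalIntegral.integral_eq_sub_of_hasDerivAt (a := 0) (b := x) (fun x _ => hwd x)
    (((continuous_decaySol a q).mul hf).intervalIntegrable _ _)
  -- the Wronskian with the growing solution
  have hg : ∀ x, HasDerivAt (fun x => growSolDeriv a q x * u x - growSol a q x * u₁ x)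
      (growSol a q x * f x) x := fun x => by
    refine (((hasDerivAt_growSolDeriv a q x).mul (hu x)).sub
      ((hasDerivAt_growSol a q x).mul (hu₁ x))).congr_deriv ?_
    ring
  have h3 := intervalIntegral.integral_eq_sub_of_hasDerivAt (a := 0) (b := x) (fun x _ => hg x)
    (((continuous_growSol a q).mul hf).intervalIntegrable _ _)
  have hW := wronskian_decaySol_growSol a q x
  rw [greenFn, h1, h2, h3]
  simp only [hw, decaySol_zero, growSolDeriv_zero, h0]
  field_simp
  linear_combination (- u x) * hW

/-! ### Weak derivatives and `H²` on the line -/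

lemma exists_tsupport_subset_Ioo {φ : ℝ → ℝ} (hφ : HasCompactSupport φ) :
    ∃ R₀ > 0, ∀ R ≥ R₀, tsupport φ ⊆ Ioo (-R) R := by
  obtain ⟨R, hR⟩ := hφ.isCompact.isBounded.subset_closedBall 0
  refine ⟨|R| + 1, by positivity, fun r hr x hx => ?_⟩
  have := hR hx
  rw [mem_closedBall_zero_iff, norm_eq_abs, abs_le] at this
  have := le_abs_self R
  constructor <;> linarith

lemma intervalIntegrable_of_locallyIntegrable {g : ℝ → ℝ} (hg : LocallyIntegrable g volume) (a b : ℝ) :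
    IntervalIntegrable g volume a b :=
  (hg.integrableOn_isCompact isCompact_uIcc).intervalIntegrable

/-- A primitive of a locally integrable function has that function as its weak derivative; this is the
integration by parts for absolutely continuous functions. -/
lemma integral_primitive_mul_deriv {g φ : ℝ → ℝ} (hg : LocallyIntegrable g volume)
    (hφ : ContDiff ℝ (⊤ : ℕ∞) φ) (hc : HasCompactSupport φ) :
    ∫ x, (∫ t in (0 : ℝ)..x, g t) * deriv φ x = -∫ x, g x * φ x := by
  obtain ⟨R, hR, hsub⟩ := exists_tsupport_subset_Ioo hc
  have hs : tsupport φ ⊆ Ioc (-R) R := (hsub R le_rfl).trans Ioo_subset_Ioc_self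
  have hend : φ R = 0 ∧ φ (-R) = 0 := by
    constructor <;> refine image_eq_zero_of_notMem_tsupport fun h => ?_
    · exact lt_irrefl _ (hsub R le_rfl h).2
    · exact lt_irrefl _ (hsub R le_rfl h).1
  rw [← intervalIntegral.integral_eq_integral_of_support_subset (a := -R) (b := R),
    ← intervalIntegral.integral_eq_integral_of_support_subset (a := -R) (b := R)]
  · have hG : AbsolutelyContinuousOnInterval (fun x => ∫ t in (0 : ℝ)..x, g t) (-R) R :=
      (intervalIntegrable_of_locallyIntegrable hg _ _).absolutelyContinuousOnInterval_intervalIntegral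
        (mem_uIcc.2 (Or.inl ⟨by linarith, hR.le⟩))
    have hφ' : AbsolutelyContinuousOnInterval φ (-R) R :=
      ((hφ.of_le (by exact_mod_cast le_top)).contDiffOn (n := 1)).absolutelyContinuousOnInterval
    rw [hG.integral_mul_deriv_eq_deriv_mul hφ', hend.1, hend.2]
    simp only [mul_zero, sub_zero, zero_sub, neg_inj]
    refine intervalIntegral.integral_congr_ae ?_
    filter_upwards [_root_.LocallyIntegrable.ae_hasDerivAt_integral hg] with x hx _
    rw [(hx 0).deriv]
  · exact (Function.support_mul_subset_right _ _).trans ((subset_tsupport _).trans hs)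
  · exact (Function.support_mul_subset_right _ _).trans ((support_deriv_subset).trans hs)

/-- The lemma of du Bois-Reymond: a test function minus the right multiple of a fixed bump has mean zero,
hence is the derivative of a test function. -/
lemma exists_ae_eq_const_of_integral_mul_deriv_eq_zero {h : ℝ → ℝ} (hh : LocallyIntegrable h volume)
    (h0 : ∀ φ : ℝ → ℝ, ContDiff ℝ (⊤ : ℕ∞) φ → HasCompactSupport φ → ∫ x, h x * deriv φ x = 0) :
    ∃ c : ℝ, h =ᵐ[volume] fun _ => c := by
  let β : ContDiffBump (0 : ℝ) := ⟨1, 2, by norm_num, by norm_num⟩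
  set χ₀ : ℝ → ℝ := β.normed volume with hχ₀
  have hχs : ContDiff ℝ (⊤ : ℕ∞) χ₀ := β.contDiff_normed
  have hχc : HasCompactSupport χ₀ := β.hasCompactSupport_normed
  have hχi : ∫ x, χ₀ x = 1 := β.integral_normed
  refine ⟨∫ x, h x * χ₀ x, ?_⟩
  set c := ∫ x, h x * χ₀ x with hc
  have key := ae_eq_zero_of_integral_contDiff_smul_eq_zero (μ := (volume : Measure ℝ))
    (f := fun x => h x - c) (hh.sub (continuous_const.locallyIntegrable)) ?_
  · filter_upwards [key] with x hx using sub_eq_zero.1 hx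
  intro χ hχ hχc'
  set I := ∫ x, χ x with hI
  set θ : ℝ → ℝ := fun x => χ x - I * χ₀ x with hθ
  have hθs : ContDiff ℝ (⊤ : ℕ∞) θ := hχ.sub (contDiff_const.mul hχs)
  have hθc : HasCompactSupport θ := hχc'.sub hχc.mul_left
  have hθint : Integrable θ := hθs.continuous.integrable_of_hasCompactSupport hθc
  have hi1 : Integrable χ := hχ.continuous.integrable_of_hasCompactSupport hχc'
  have hi2 : Integrable χ₀ := hχs.continuous.integrable_of_hasCompactSupport hχc
  have hθ0 : ∫ x, θ x = 0 := by
    rw [hθ, integral_sub hi1 (hi2.const_mul I), integral_const_mul, hχi]; simp [hI]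
  obtain ⟨R, hR, hsub⟩ := exists_tsupport_subset_Ioo hθc
  have hs : tsupport θ ⊆ Ioo (-R) R := hsub R le_rfl
  -- the primitive of `θ` is a test function since `θ` has mean zero
  set φ : ℝ → ℝ := fun x => ∫ t in (-R)..x, θ t with hφ
  have hφd : ∀ x, HasDerivAt φ (θ x) x := fun x =>
    intervalIntegral.integral_hasDerivAt_right (hθs.continuous.intervalIntegrable _ _)
      hθs.continuous.aestronglyMeasurable.stronglyMeasurableAtFilter hθs.continuous.continuousAt
  have hderiv : deriv φ = θ := funext fun x => (hφd x).deriv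
  have hφs : ContDiff ℝ (⊤ : ℕ∞) φ :=
    contDiff_infty_iff_deriv.2 ⟨fun x => (hφd x).differentiableAt, by rw [hderiv]; exact hθs⟩
  have hφc : HasCompactSupport φ := by
    refine HasCompactSupport.of_support_subset_isCompact (isCompact_Icc (a := -R) (b := R)) ?_
    intro x hx
    by_contra hxn
    apply hx
    rw [mem_Icc, not_and_or, not_le, not_le] at hxn
    rcases hxn with hxn | hxn
    · have : ∫ t in (-R)..x, θ t = ∫ t in (-R)..x, (0 : ℝ) := by
        refine intervalIntegral.integral_congr fun t ht => ?_
        rw [uIcc_of_ge hxn.le] at ht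
        exact image_eq_zero_of_notMem_tsupport fun h => absurd (hs h).1 (not_lt.2 ht.2)
      simpa [hφ] using this
    · have : ∫ t in (-R)..x, θ t = ∫ t, θ t :=
        intervalIntegral.integral_eq_integral_of_support_subset
          ((subset_tsupport _).trans (hs.trans fun y hy => ⟨hy.1, (hy.2.trans hxn).le⟩))
      simpa [hφ, hθ0] using this
  have h1 := h0 φ hφs hφc
  rw [hderiv] at h1
  have hint1 : Integrable fun x => h x * χ x :=
    hh.integrable_smul_right_of_hasCompactSupport hχ.continuous hχc'
  have hint2 : Integrable fun x => h x * χ₀ x :=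
    hh.integrable_smul_right_of_hasCompactSupport hχs.continuous hχc
  have h2 : ∫ x, h x * θ x = (∫ x, h x * χ x) - I * c := by
    rw [hc, ← integral_const_mul, ← integral_sub hint1 (hint2.const_mul I)]
    congr 1; funext x; simp only [hθ]; ring
  have h3 : ∫ x, χ x • (h x - c) = (∫ x, h x * χ x) - I * c := by
    rw [hI, ← integral_mul_const, ← integral_sub hint1 (hi1.mul_const c)]
    congr 1; funext x; simp only [smul_eq_mul]; ring
  rw [h3, ← h2, h1]

lemma integrable_mul_test {f φ : ℝ → ℝ} (hf : LocallyIntegrable f volume) (hφ : Continuous φ)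
    (hc : HasCompactSupport φ) : Integrable fun x => f x * φ x :=
  hf.integrable_smul_right_of_hasCompactSupport hφ hc

lemma continuous_primitive_of_locallyIntegrable {g : ℝ → ℝ} (hg : LocallyIntegrable g volume) :
    Continuous fun x => ∫ t in (0 : ℝ)..x, g t :=
  intervalIntegral.continuous_primitive (fun a b => intervalIntegrable_of_locallyIntegrable hg a b) 0

lemma IsWeakDeriv.exists_ae_eq_primitive {f g : ℝ → ℝ} (h : IsWeakDeriv f g) :
    ∃ c : ℝ, f =ᵐ[volume] fun x => c + ∫ t in (0 : ℝ)..x, g t := by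
  obtain ⟨hf, hg, hfg⟩ := h
  have hG := continuous_primitive_of_locallyIntegrable hg
  obtain ⟨c, hc⟩ := exists_ae_eq_const_of_integral_mul_deriv_eq_zero (hf.sub hG.locallyIntegrable) (by
    intro φ hφ hφc
    have hd : Continuous (deriv φ) := hφ.continuous_deriv (by exact_mod_cast le_top)
    simp only [Pi.sub_apply, sub_mul]
    rw [integral_sub (integrable_mul_test hf hd hφc.deriv)
      (integrable_mul_test hG.locallyIntegrable hd hφc.deriv), hfg φ hφ hφc,
      integral_primitive_mul_deriv hg hφ hφc, sub_self])
  refine ⟨c, ?_⟩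
  filter_upwards [hc] with x hx
  simp only [Pi.sub_apply] at hx
  linarith

lemma IsWeakDeriv.ae_unique {f g g' : ℝ → ℝ} (h : IsWeakDeriv f g) (h' : IsWeakDeriv f g') :
    g =ᵐ[volume] g' := by
  have key := ae_eq_zero_of_integral_contDiff_smul_eq_zero (μ := (volume : Measure ℝ))
    (f := fun x => g x - g' x) (h.2.1.sub h'.2.1) (by
      intro φ hφ hφc
      have e : ∀ x, φ x • (g x - g' x) = g x * φ x - g' x * φ x := fun x => by
        rw [smul_eq_mul]; ring
      simp only [e]
      rw [integral_sub (integrable_mul_test h.2.1 hφ.continuous hφc)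
        (integrable_mul_test h'.2.1 hφ.continuous hφc)]
      have h1 := h.2.2 φ hφ hφc
      have h2 := h'.2.2 φ hφ hφc
      linarith)
  filter_upwards [key] with x hx using sub_eq_zero.1 hx

lemma IsWeakDeriv.congr {f f' g g' : ℝ → ℝ} (h : IsWeakDeriv f g) (hf : f =ᵐ[volume] f')
    (hg : g =ᵐ[volume] g') : IsWeakDeriv f' g' := by
  refine ⟨h.1.congr hf, h.2.1.congr hg, fun φ hφ hφc => ?_⟩
  have e1 : ∫ x, f x * deriv φ x = ∫ x, f' x * deriv φ x :=
    integral_congr_ae (hf.mono fun x hx => by simp only [hx])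
  have e2 : ∫ x, g x * φ x = ∫ x, g' x * φ x :=
    integral_congr_ae (hg.mono fun x hx => by simp only [hx])
  rw [← e1, ← e2]
  exact h.2.2 φ hφ hφc

lemma IsWeakDeriv.isWeakDeriv_weakDeriv {f g : ℝ → ℝ} (h : IsWeakDeriv f g) :
    IsWeakDeriv f (weakDeriv f) := by
  have hex : ∃ g, IsWeakDeriv f g := ⟨g, h⟩
  rw [weakDeriv, dif_pos hex]
  exact hex.choose_spec

lemma IsWeakDeriv.weakDeriv_ae_eq {f g : ℝ → ℝ} (h : IsWeakDeriv f g) : weakDeriv f =ᵐ[volume] g :=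
  h.isWeakDeriv_weakDeriv.ae_unique h

lemma IsWeakDeriv.weakDeriv_weakDeriv_ae_eq {f g g' : ℝ → ℝ} (h : IsWeakDeriv f g)
    (h' : IsWeakDeriv g g') : weakDeriv (weakDeriv f) =ᵐ[volume] g' :=
  (h'.congr h.weakDeriv_ae_eq.symm (ae_eq_refl g')).weakDeriv_ae_eq

lemma isWeakDeriv_of_hasDerivAt {u u₁ : ℝ → ℝ} (hu : ∀ x, HasDerivAt u (u₁ x) x)
    (hu₁ : Continuous u₁) : IsWeakDeriv u u₁ := by
  have hc : Continuous u := continuous_iff_continuousAt.2 fun x => (hu x).continuousAt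
  refine ⟨hc.locallyIntegrable, hu₁.locallyIntegrable, fun φ hφ hφc => ?_⟩
  have hd : Continuous (deriv φ) := hφ.continuous_deriv (by exact_mod_cast le_top)
  exact integral_mul_deriv_eq_deriv_mul_of_integrable (fun x _ => hu x)
    (fun x _ => (hφ.differentiable (by simp) x).hasDerivAt)
    (integrable_mul_test hc.locallyIntegrable hd hφc.deriv)
    (integrable_mul_test hu₁.locallyIntegrable hφ.continuous hφc)
    (integrable_mul_test hc.locallyIntegrable hφ.continuous hφc)

/-- The Sobolev embedding of `H¹` into bounded continuous functions, by averaging over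
`[x, x + 1]`. -/
lemma sq_le_of_primitive {u g : ℝ → ℝ} (hg : MemLp g 2 volume) (hu : MemLp u 2 volume)
    (h : ∀ x, u x = u 0 + ∫ t in (0 : ℝ)..x, g t) (x : ℝ) :
    u x ^ 2 ≤ 2 * ((∫ y, u y ^ 2) + ∫ y, g y ^ 2) := by
  have hgl : LocallyIntegrable g volume := hg.locallyIntegrable (by norm_num)
  have hgi := intervalIntegrable_of_locallyIntegrable hgl
  have hg2 : Integrable fun y => g y ^ 2 := (memLp_two_iff_integrable_sq hg.1).1 hg
  have hu2 : Integrable fun y => u y ^ 2 := (memLp_two_iff_integrable_sq hu.1).1 hu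
  have hx1 : x ≤ x + 1 := by linarith
  set s := ∫ t in x..(x + 1), |g t| with hs
  have hle : ∀ F : ℝ → ℝ, Integrable F → (∀ y, 0 ≤ F y) → ∫ t in x..(x + 1), F t ≤ ∫ t, F t := by
    intro F hF hF0
    rw [intervalIntegral.integral_of_le hx1]
    exact setIntegral_le_integral hF (Eventually.of_forall hF0)
  -- Cauchy–Schwarz on the unit interval, from `∫ (|g| - s)² ≥ 0`
  have hs2 : s ^ 2 ≤ ∫ y, g y ^ 2 := by
    refine le_trans ?_ (hle _ hg2 fun y => sq_nonneg _)
    have h1 : 0 ≤ ∫ t in x..(x + 1), (|g t| - s) ^ 2 :=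
      intervalIntegral.integral_nonneg hx1 fun t _ => sq_nonneg _
    have h2 : ∫ t in x..(x + 1), (|g t| - s) ^ 2 = (∫ t in x..(x + 1), g t ^ 2) - s ^ 2 := by
      have e : ∀ t, (|g t| - s) ^ 2 = g t ^ 2 - 2 * s * |g t| + s ^ 2 := fun t => by
        rw [← sq_abs (g t)]; ring
      simp only [e]
      rw [intervalIntegral.integral_add, intervalIntegral.integral_sub,
        intervalIntegral.integral_const_mul, ← hs, intervalIntegral.integral_const]
      · simp only [add_sub_cancel_left, smul_eq_mul, one_mul]; ring
      · exact hg2.intervalIntegrable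
      · exact (hgi _ _).abs.const_mul _
      · exact hg2.intervalIntegrable.sub ((hgi _ _).abs.const_mul _)
      · exact intervalIntegrable_const
    linarith
  have hpt : ∀ y ∈ Icc x (x + 1), u x ^ 2 ≤ 2 * u y ^ 2 + 2 * s ^ 2 := by
    intro y hy
    have h1 : u y - u x = ∫ t in x..y, g t := by
      rw [h y, h x, ← intervalIntegral.integral_add_adjacent_intervals (hgi 0 x) (hgi x y)]; ring
    have h2 : |u y - u x| ≤ s := by
      rw [h1, hs]
      refine (intervalIntegral.abs_integral_le_integral_abs hy.1).trans ?_
      exact intervalIntegral.integral_mono_interval le_rfl hy.1 hy.2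
        (Eventually.of_forall fun t => abs_nonneg (g t)) (hgi _ _).abs
    have h3 : (u y - u x) ^ 2 ≤ s ^ 2 := by
      rw [← sq_abs (u y - u x)]; exact pow_le_pow_left₀ (abs_nonneg _) h2 2
    nlinarith [sq_nonneg (u x - 2 * u y)]
  have h4 : ∫ _ in x..(x + 1), u x ^ 2 ≤ ∫ y in x..(x + 1), (2 * u y ^ 2 + 2 * s ^ 2) :=
    intervalIntegral.integral_mono_on hx1 intervalIntegrable_const
      ((hu2.intervalIntegrable.const_mul 2).add intervalIntegrable_const) hpt
  rw [intervalIntegral.integral_add (hu2.intervalIntegrable.const_mul 2) intervalIntegrable_const,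
    intervalIntegral.integral_const_mul, intervalIntegral.integral_const,
    intervalIntegral.integral_const] at h4
  simp only [add_sub_cancel_left, smul_eq_mul, one_mul] at h4
  have h5 := hle _ hu2 fun y => sq_nonneg _
  linarith

/-- The continuously differentiable representative `u` of an `H²` function, with the Sobolev bounds; its
derivative `u₁` is a primitive of the second weak derivative. -/
lemma MemH2.exists_rep {f : ℝ → ℝ} (hf : MemH2 f) :
    ∃ u u₁ g : ℝ → ℝ, f =ᵐ[volume] u ∧ (∀ x, HasDerivAt u (u₁ x) x) ∧ Continuous u₁ ∧
      (∀ x, u₁ x = u₁ 0 + ∫ t in (0 : ℝ)..x, g t) ∧ weakDeriv (weakDeriv f) =ᵐ[volume] g ∧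
      (∀ x, |u x| ≤ 2 * h2Norm f) ∧ ∀ x, |u₁ x| ≤ 2 * h2Norm f := by
  obtain ⟨f₁, f₂, h1, h2, m0, m1, m2⟩ := hf
  obtain ⟨c, hc⟩ := h1.exists_ae_eq_primitive
  obtain ⟨d, hd⟩ := h2.exists_ae_eq_primitive
  set u₁ : ℝ → ℝ := fun x => d + ∫ t in (0 : ℝ)..x, f₂ t with hu₁
  have hu₁c : Continuous u₁ := continuous_const.add (continuous_primitive_of_locallyIntegrable h2.2.1)
  set u : ℝ → ℝ := fun x => c + ∫ t in (0 : ℝ)..x, u₁ t with hu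
  have hfu : f =ᵐ[volume] u := by
    filter_upwards [hc] with x hx
    rw [hx, hu]
    simp only
    rw [intervalIntegral.integral_congr_ae (hd.mono fun t ht _ => ht)]
  have hud : ∀ x, HasDerivAt u (u₁ x) x := fun x =>
    (hasDerivAt_integral_of_continuous hu₁c x).const_add c
  have w1 := h1.weakDeriv_ae_eq
  have w2 := h1.weakDeriv_weakDeriv_ae_eq h2
  have hn : h2Norm f ^ 2 = (∫ x, f x ^ 2) + (∫ x, f₁ x ^ 2) + ∫ x, f₂ x ^ 2 := by
    have e1 : ∫ x, weakDeriv f x ^ 2 = ∫ x, f₁ x ^ 2 :=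
      integral_congr_ae (w1.mono fun x hx => by simp only [hx])
    have e2 : ∫ x, weakDeriv (weakDeriv f) x ^ 2 = ∫ x, f₂ x ^ 2 :=
      integral_congr_ae (w2.mono fun x hx => by simp only [hx])
    rw [h2Norm, e1, e2, sq_sqrt]
    exact add_nonneg (add_nonneg (integral_nonneg fun x => sq_nonneg _)
      (integral_nonneg fun x => sq_nonneg _)) (integral_nonneg fun x => sq_nonneg _)
  have hn0 : 0 ≤ h2Norm f := sqrt_nonneg _
  have i0 : 0 ≤ ∫ x, f x ^ 2 := integral_nonneg fun x => sq_nonneg _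
  have i2 : 0 ≤ ∫ x, f₂ x ^ 2 := integral_nonneg fun x => sq_nonneg _
  refine ⟨u, u₁, f₂, hfu, hud, hu₁c, fun x => by simp [hu₁], w2, fun x => ?_, fun x => ?_⟩
  · have := sq_le_of_primitive (u := u) (g := u₁) (m1.ae_eq hd) (m0.ae_eq hfu)
      (fun x => by simp [hu]) x
    have e0 : ∫ x, u x ^ 2 = ∫ x, f x ^ 2 :=
      integral_congr_ae (hfu.mono fun x hx => by simp only [hx])
    have e1 : ∫ x, u₁ x ^ 2 = ∫ x, f₁ x ^ 2 :=
      integral_congr_ae (hd.mono fun x hx => by simp only [hx])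
    rw [e0, e1] at this
    refine abs_le_of_sq_le_sq (b := 2 * h2Norm f) ?_ (by positivity)
    nlinarith
  · have := sq_le_of_primitive (u := u₁) (g := f₂) m2 (m1.ae_eq hd) (fun x => by simp [hu₁]) x
    have e1 : ∫ x, u₁ x ^ 2 = ∫ x, f₁ x ^ 2 :=
      integral_congr_ae (hd.mono fun x hx => by simp only [hx])
    rw [e1] at this
    refine abs_le_of_sq_le_sq (b := 2 * h2Norm f) ?_ (by positivity)
    nlinarith

lemma weakDeriv_weakDeriv_ae_eq_of_hasDerivAt {u u₁ u₂ : ℝ → ℝ}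
    (hu : ∀ x, HasDerivAt u (u₁ x) x) (hu₁ : ∀ x, HasDerivAt u₁ (u₂ x) x) (hu₂ : Continuous u₂) :
    weakDeriv (weakDeriv u) =ᵐ[volume] u₂ :=
  (isWeakDeriv_of_hasDerivAt hu
    (continuous_iff_continuousAt.2 fun x => (hu₁ x).continuousAt)).weakDeriv_weakDeriv_ae_eq
    (isWeakDeriv_of_hasDerivAt hu₁ hu₂)

lemma integrable_sq_of_decay {η M : ℝ} (hη : 0 < η) {u : ℝ → ℝ} (hu : Continuous u)
    (h : ∀ x, |u x| ≤ M * exp (-(η * |x|))) :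
    Integrable (fun x => u x ^ 2) ∧ ∫ x, u x ^ 2 ≤ M ^ 2 * ∫ x, exp (-(2 * η * |x|)) := by
  have hi := (integrable_exp_neg_mul_abs (m := 2 * η) (by positivity)).const_mul (M ^ 2)
  have hpt : ∀ x, u x ^ 2 ≤ M ^ 2 * exp (-(2 * η * |x|)) := fun x => by
    rw [← sq_abs]
    calc |u x| ^ 2 ≤ (M * exp (-(η * |x|))) ^ 2 := pow_le_pow_left₀ (abs_nonneg _) (h x) 2
      _ = _ := by rw [mul_pow, ← exp_nat_mul]; push_cast; ring_nf
  have h1 : Integrable (fun x => u x ^ 2) := hi.mono' (hu.pow 2).aestronglyMeasurable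
    (Eventually.of_forall fun x => by rw [norm_of_nonneg (sq_nonneg _)]; exact hpt x)
  refine ⟨h1, ?_⟩
  rw [← integral_const_mul]
  exact integral_mono h1 hi hpt

/-- A `C²` function decaying exponentially together with its derivatives lies in `H²`, with a norm
bound. -/
lemma memH2_of_decay {η M : ℝ} (hη : 0 < η) {u u₁ u₂ : ℝ → ℝ}
    (hu : ∀ x, HasDerivAt u (u₁ x) x) (hu₁ : ∀ x, HasDerivAt u₁ (u₂ x) x) (hu₂ : Continuous u₂)
    (h0 : ∀ x, |u x| ≤ M * exp (-(η * |x|))) (h1 : ∀ x, |u₁ x| ≤ M * exp (-(η * |x|)))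
    (h2 : ∀ x, |u₂ x| ≤ M * exp (-(η * |x|))) :
    MemH2 u ∧ h2Norm u ≤ M * sqrt (3 * ∫ x, exp (-(2 * η * |x|))) := by
  have hc : Continuous u := continuous_iff_continuousAt.2 fun x => (hu x).continuousAt
  have hc₁ : Continuous u₁ := continuous_iff_continuousAt.2 fun x => (hu₁ x).continuousAt
  have w := isWeakDeriv_of_hasDerivAt hu hc₁
  have w₁ := isWeakDeriv_of_hasDerivAt hu₁ hu₂
  have i0 := integrable_sq_of_decay hη hc h0
  have i1 := integrable_sq_of_decay hη hc₁ h1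
  have i2 := integrable_sq_of_decay hη hu₂ h2
  have hM : 0 ≤ M := by simpa using (abs_nonneg _).trans (h0 0)
  refine ⟨⟨u₁, u₂, w, w₁, (memLp_two_iff_integrable_sq hc.aestronglyMeasurable).2 i0.1,
    (memLp_two_iff_integrable_sq hc₁.aestronglyMeasurable).2 i1.1,
    (memLp_two_iff_integrable_sq hu₂.aestronglyMeasurable).2 i2.1⟩, ?_⟩
  have e1 : ∫ x, weakDeriv u x ^ 2 = ∫ x, u₁ x ^ 2 :=
    integral_congr_ae (w.weakDeriv_ae_eq.mono fun x hx => by simp only [hx])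
  have e2 : ∫ x, weakDeriv (weakDeriv u) x ^ 2 = ∫ x, u₂ x ^ 2 :=
    integral_congr_ae ((w.weakDeriv_weakDeriv_ae_eq w₁).mono fun x hx => by simp only [hx])
  rw [h2Norm, e1, e2]
  refine sqrt_le_iff.2 ⟨by positivity, ?_⟩
  rw [mul_pow, sq_sqrt (mul_nonneg (by norm_num) (integral_nonneg fun x => (exp_pos _).le))]
  linarith [i0.2, i1.2, i2.2]

/-! ### The rescaled bifurcation equation -/

section Bifurcation

variable {X : Type*} [NormedCommRing X] [NormedAlgebra ℝ X]

/-- The right-hand side of the rescaled equation for the amplitude `h`, with `ω` the distance to the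
bifurcation point, `w` the rescaled first component and `t` the square of the amplitude. -/
def bifSource (ρ g : X) (k ω : ℝ) (x : X × X × ℝ) : X :=
  ω • (g + x.2.1) + (k * x.2.2) • (ρ * x.1 * (g + x.2.1))

/-- The rescaled bifurcation equation. Its unknown is `x = (w, h, t)`; `g` spans the kernel, `K₁` and `K₂`
are the inverses of the linearisations and `ℓ` is the pairing with the kernel. An element `f` of `X`
stands for the function `ρ f` with `ρ` a weight, so that the product of two functions is represented by
`ρ * f₁ * f₂`. -/
def bifMap (ρ g : X) (K₁ K₂ : X →L[ℝ] X) (ℓ : X →L[ℝ] ℝ) (k ω : ℝ) (x : X × X × ℝ) : X × X × ℝ :=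
  (x.1 - K₁ ((x.2.2 / 2) • (ρ * x.1 * x.1) + ρ * ((g + x.2.1) * (g + x.2.1))),
    x.2.1 - K₂ (bifSource ρ g k ω x), ℓ (bifSource ρ g k ω x))

/-- The derivative of `(ω, x) ↦ (ω, bifMap ω x)` at `ω = 0`, `x = (W, 0, 0)`. The parameter is kept as a
coordinate so that the inverse function theorem applies uniformly in `ω`. -/
lemma hasStrictFDerivAt_bifMap (ρ g : X) (K₁ K₂ : X →L[ℝ] X) (ℓ : X →L[ℝ] ℝ) (k : ℝ)
    (W : X) :
    ∃ L : (ℝ × X × X × ℝ) →L[ℝ] (ℝ × X × X × ℝ),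
      (∀ v, L v = (v.1,
        v.2.1 - K₁ ((v.2.2.2 / 2) • (ρ * W * W) + (2 : ℝ) • (ρ * (g * v.2.2.1))),
        v.2.2.1 - K₂ (v.1 • g + (k * v.2.2.2) • (ρ * W * g)),
        ℓ (v.1 • g + (k * v.2.2.2) • (ρ * W * g)))) ∧
      HasStrictFDerivAt (fun p : ℝ × X × X × ℝ => (p.1, bifMap ρ g K₁ K₂ ℓ k p.1 p.2)) L
        (0, W, 0, 0) := by
  set p₀ : ℝ × X × X × ℝ := (0, W, 0, 0) with hp₀
  have h1 : HasStrictFDerivAt (fun p : ℝ × X × X × ℝ => p.1) (ContinuousLinearMap.fst ℝ _ _) p₀ :=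
    hasStrictFDerivAt_fst
  have hs : HasStrictFDerivAt (fun p : ℝ × X × X × ℝ => p.2) (ContinuousLinearMap.snd ℝ _ _) p₀ :=
    hasStrictFDerivAt_snd
  have h2 := hs.fst
  have hs2 := hs.snd
  have h3 := hs2.fst
  have h4 := hs2.snd
  have hg := h3.const_add g
  have hA := ((h4.mul_const (1 / 2 : ℝ)).smul ((h2.const_mul ρ).mul h2)).add ((hg.mul hg).const_mul ρ)
  have hB := (h1.smul hg).add ((h4.const_mul k).smul ((h2.const_mul ρ).mul hg))
  have hF1 := h2.sub (K₁.hasStrictFDerivAt.comp p₀ hA)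
  have hF2 := h3.sub (K₂.hasStrictFDerivAt.comp p₀ hB)
  have hF3 := ℓ.hasStrictFDerivAt.comp p₀ hB
  have hF := h1.prodMk (hF1.prodMk (hF2.prodMk hF3))
  refine ⟨_, fun v => ?_, hF.congr_of_eventuallyEq (Eventually.of_forall fun p => ?_)⟩
  · simp only [hp₀, ContinuousLinearMap.prod_apply, ContinuousLinearMap.coe_fst',
      _root_.sub_apply, ContinuousLinearMap.comp_apply, _root_.add_apply,
      _root_.smul_apply, ContinuousLinearMap.coe_snd',
      ContinuousLinearMap.smulRight_apply, add_zero, zero_smul, mul_zero, zero_mul,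
      zero_add, smul_eq_mul]
    congr 1
    congr 1
    · congr 2
      congr 1
      · congr 1
        simp; ring
      · rw [ofNat_smul_eq_nsmul]; simp; ring
    · congr 1
      · congr 2; simp
      · congr 1; simp
  · simp only [bifMap, bifSource, Pi.add_apply, Pi.sub_apply]
    simp [div_eq_mul_inv]

/-- Near the base point the bifurcation equation has exactly one solution for each small `ω`: the
linearisation is triangular, and its last diagonal entry is `k * ℓ (ρ * W * g) ≠ 0`. -/
theorem bifMap_existsUnique [CompleteSpace X] (ρ g : X) (K₁ K₂ : X →L[ℝ] X) (ℓ : X →L[ℝ] ℝ) {k : ℝ}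
    (hk : k ≠ 0) {W : X} (hW : W = K₁ (ρ * (g * g))) (hQ : ℓ (ρ * W * g) ≠ 0) :
    (∃ r > 0, ∀ ω : ℝ, |ω| < r → ∀ x ∈ Metric.ball (W, (0 : X), (0 : ℝ)) r,
      ∀ y ∈ Metric.ball (W, (0 : X), (0 : ℝ)) r, bifMap ρ g K₁ K₂ ℓ k ω x = 0 →
        bifMap ρ g K₁ K₂ ℓ k ω y = 0 → x = y) ∧
    ∀ r > 0, ∃ δ > 0, ∀ ω : ℝ, |ω| < δ → ∃ x ∈ Metric.ball (W, (0 : X), (0 : ℝ)) r,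
      bifMap ρ g K₁ K₂ ℓ k ω x = 0 := by
  obtain ⟨L, hL, hd⟩ := hasStrictFDerivAt_bifMap ρ g K₁ K₂ ℓ k W
  set Φ : ℝ × X × X × ℝ → ℝ × X × X × ℝ := fun p => (p.1, bifMap ρ g K₁ K₂ ℓ k p.1 p.2) with hΦ
  have hker : (L : (ℝ × X × X × ℝ) →ₗ[ℝ] (ℝ × X × X × ℝ)).ker = ⊥ := by
    refine LinearMap.ker_eq_bot'.2 fun v hv => ?_
    have hv' : L v = 0 := hv
    rw [hL] at hv'
    obtain ⟨a, b, c, d⟩ := v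
    simp only [Prod.mk_eq_zero] at hv' ⊢
    obtain ⟨ha, hb, hc, hd⟩ := hv'
    subst ha
    simp only [zero_smul, zero_add, map_smul, smul_eq_mul, mul_eq_zero, hQ, or_false, hk,
      false_or] at hd
    subst hd
    simp only [zero_smul, mul_zero, add_zero, map_zero, sub_zero] at hc
    subst hc
    simpa using hb
  -- back substitution: first `t` from the last entry, then `h`, then `w`
  have hrange : (L : (ℝ × X × X × ℝ) →ₗ[ℝ] (ℝ × X × X × ℝ)).range = ⊤ := by
    refine LinearMap.range_eq_top.2 fun y => ?_
    obtain ⟨a, b, c, d⟩ := y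
    set t := (d - a * ℓ g) / (k * ℓ (ρ * W * g)) with ht
    set h := c + K₂ (a • g + (k * t) • (ρ * W * g)) with hh
    refine ⟨(a, b + K₁ ((t / 2) • (ρ * W * W) + (2 : ℝ) • (ρ * (g * h))), h, t), ?_⟩
    change L _ = _
    rw [hL]
    simp only [Prod.mk.injEq, add_sub_cancel_right, true_and]
    refine ⟨by rw [hh, add_sub_cancel_right], ?_⟩
    rw [map_add, map_smul, map_smul, smul_eq_mul, smul_eq_mul, ht]
    field_simp
    ring
  let e := ContinuousLinearEquiv.ofBijective L hker hrange
  have hd' : HasStrictFDerivAt Φ (e : (ℝ × X × X × ℝ) →L[ℝ] (ℝ × X × X × ℝ)) (0, W, 0, 0) := by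
    rw [ContinuousLinearEquiv.coe_ofBijective]; exact hd
  have hΦ0 : Φ (0, W, 0, 0) = 0 := by
    simp [hΦ, bifMap, bifSource, ← hW]
  constructor
  · have hs : (hd'.toOpenPartialHomeomorph Φ).source ∈ 𝓝 ((0 : ℝ), W, (0 : X), (0 : ℝ)) :=
      (hd'.toOpenPartialHomeomorph Φ).open_source.mem_nhds hd'.mem_toOpenPartialHomeomorph_source
    obtain ⟨r, hr, hsub⟩ := Metric.mem_nhds_iff.1 hs
    refine ⟨r, hr, fun ω hω x hx y hy hx0 hy0 => ?_⟩
    have hmem : ∀ z ∈ Metric.ball (W, (0 : X), (0 : ℝ)) r,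
        (ω, z) ∈ (hd'.toOpenPartialHomeomorph Φ).source := fun z hz => hsub (by
      rw [← ball_prod_same]
      exact ⟨by simpa using hω, hz⟩)
    have := (hd'.toOpenPartialHomeomorph Φ).injOn (hmem x hx) (hmem y hy) (by
      simp only [HasStrictFDerivAt.toOpenPartialHomeomorph_coe, hΦ, hx0, hy0])
    exact (Prod.mk.inj this).2
  · intro r hr
    have hmap := hd'.map_nhds_eq_of_equiv
    have him : Φ '' Metric.ball ((0 : ℝ), W, (0 : X), (0 : ℝ)) r ∈ 𝓝 (Φ (0, W, 0, 0)) := by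
      rw [← hmap]
      exact image_mem_map (Metric.ball_mem_nhds _ hr)
    rw [hΦ0] at him
    obtain ⟨δ, hδ, hsub⟩ := Metric.mem_nhds_iff.1 him
    refine ⟨δ, hδ, fun ω hω => ?_⟩
    obtain ⟨⟨ω', x⟩, hx, hx0⟩ := hsub (show ((ω, 0) : ℝ × X × X × ℝ) ∈ Metric.ball 0 δ by
      rw [mem_ball_zero_iff, Prod.norm_def]; simpa [hδ] using hω)
    simp only [hΦ, Prod.mk.injEq] at hx0
    obtain ⟨rfl, hx0⟩ := hx0
    rw [← ball_prod_same] at hx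
    exact ⟨x, hx.2, hx0⟩

end Bifurcation

/-! ### The inverse operators on weighted spaces of bounded continuous functions -/

lemma greenFn_add {a q M N : ℝ} (ha : 0 < a) (hq : 0 < q) {f g : ℝ → ℝ} (hf : Continuous f)
    (hg : Continuous g) (hM : ∀ x, |f x| ≤ M) (hN : ∀ x, |g x| ≤ N) (x : ℝ) :
    greenFn a q (fun y => f y + g y) x = greenFn a q f x + greenFn a q g x := by
  have i1 := integrable_decaySol_mul ha hq hf hM
  have i2 := integrable_decaySol_mul ha hq hg hN
  simp only [greenFn, mul_add]
  rw [integral_add i1.integrableOn i2.integrableOn,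
    intervalIntegral.integral_add i1.intervalIntegrable i2.intervalIntegrable,
    intervalIntegral.integral_add (f := fun y => growSol a q y * f y)
      (g := fun y => growSol a q y * g y)
      (((continuous_growSol a q).mul hf).intervalIntegrable _ _)
      (((continuous_growSol a q).mul hg).intervalIntegrable _ _)]
  ring

lemma greenFn_const_mul (a q c : ℝ) (f : ℝ → ℝ) (x : ℝ) :
    greenFn a q (fun y => c * f y) x = c * greenFn a q f x := by
  simp only [greenFn, mul_left_comm _ c, integral_const_mul, intervalIntegral.integral_const_mul]
  ring

lemma exp_neg_mul_abs_le_one {η : ℝ} (hη : 0 ≤ η) (x : ℝ) : exp (-(η * |x|)) ≤ 1 :=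
  exp_le_one_iff.2 (neg_nonpos.2 (by positivity))

/-- The weight `exp (-η |x|)`. A bounded continuous function `F` stands for `expWeight η * F`, so that the
decay rate `η` becomes a parameter of the equation instead of the space. -/
def expWeight (η : ℝ) (x : ℝ) : ℝ := exp (-(η * |x|))

lemma expWeight_pos (η x : ℝ) : 0 < expWeight η x := exp_pos _

lemma expWeight_neg (η x : ℝ) : expWeight η (-x) = expWeight η x := by simp [expWeight]

lemma expWeight_le_one {η : ℝ} (hη : 0 ≤ η) (x : ℝ) : expWeight η x ≤ 1 :=
  exp_neg_mul_abs_le_one hη x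

lemma expWeight_zero (x : ℝ) : expWeight 0 x = 1 := by simp [expWeight]

lemma continuous_expWeight (η : ℝ) : Continuous (expWeight η) := by
  unfold expWeight; fun_prop

lemma abs_apply_le (F : ℝ →ᵇ ℝ) (x : ℝ) : |F x| ≤ ‖F‖ := F.norm_coe_le_norm x

lemma abs_expWeight_mul_le (η : ℝ) (F : ℝ →ᵇ ℝ) (x : ℝ) :
    |expWeight η x * F x| ≤ ‖F‖ * exp (-(η * |x|)) := by
  rw [abs_mul, abs_of_pos (expWeight_pos η x), mul_comm]
  exact mul_le_mul_of_nonneg_right (abs_apply_le F x) (expWeight_pos η x).le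

lemma abs_expWeight_mul_le_norm {η : ℝ} (hη : 0 ≤ η) (F : ℝ →ᵇ ℝ) (x : ℝ) :
    |expWeight η x * F x| ≤ ‖F‖ :=
  (abs_expWeight_mul_le η F x).trans
    (mul_le_of_le_one_right (norm_nonneg _) (exp_neg_mul_abs_le_one hη x))

lemma continuous_expWeight_mul (η : ℝ) (F : ℝ →ᵇ ℝ) : Continuous fun x => expWeight η x * F x :=
  (continuous_expWeight η).mul F.continuous

/-- A function with the decay of the weight is represented by a bounded continuous function. -/
lemma exists_boundedContinuous {η M : ℝ} {f : ℝ → ℝ} (hf : Continuous f)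
    (h : ∀ x, |f x| ≤ M * exp (-(η * |x|))) :
    ∃ F : ℝ →ᵇ ℝ, (∀ x, expWeight η x * F x = f x) ∧ ‖F‖ ≤ M := by
  have hM : 0 ≤ M := by simpa using (abs_nonneg _).trans (h 0)
  have hb : ∀ x, ‖(expWeight η x)⁻¹ * f x‖ ≤ M := fun x => by
    rw [norm_eq_abs, abs_mul, abs_of_pos (inv_pos.2 (expWeight_pos η x)),
      inv_mul_le_iff₀ (expWeight_pos η x), mul_comm]
    exact h x
  refine ⟨BoundedContinuousFunction.ofNormedAddCommGroup (fun x => (expWeight η x)⁻¹ * f x)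
    (((continuous_expWeight η).inv₀ fun x => (expWeight_pos η x).ne').mul hf) M hb, fun x => ?_,
    BoundedContinuousFunction.norm_ofNormedAddCommGroup_le _ hM _⟩
  simp [mul_inv_cancel_left₀ (expWeight_pos η x).ne']

/-- The pairing with the decaying solution, as a functional on the weighted space. -/
lemma exists_pairing {a q η : ℝ} (ha : 0 < a) (hq : 0 < q) (hη : 0 ≤ η) :
    ∃ ℓ : (ℝ →ᵇ ℝ) →L[ℝ] ℝ, ∀ F, ℓ F = ∫ x, decaySol a q x * (expWeight η x * F x) := by
  have hint : ∀ F : ℝ →ᵇ ℝ, Integrable fun x => decaySol a q x * (expWeight η x * F x) := fun F =>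
    integrable_decaySol_mul ha hq (continuous_expWeight_mul η F) (abs_expWeight_mul_le_norm hη F)
  have hφ : Integrable fun x => |decaySol a q x| := by
    have := (integrable_decaySol_mul (f := fun _ => 1) (M := 1) ha hq continuous_const (by simp)).abs
    simpa using this
  refine ⟨LinearMap.mkContinuous
    { toFun := fun F => ∫ x, decaySol a q x * (expWeight η x * F x)
      map_add' := fun F G => by
        rw [← integral_add (hint F) (hint G)]
        congr 1; funext x
        rw [BoundedContinuousFunction.add_apply]; ring
      map_smul' := fun c F => by
        rw [RingHom.id_apply, smul_eq_mul, ← integral_const_mul]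
        congr 1; funext x
        rw [BoundedContinuousFunction.smul_apply, smul_eq_mul]; ring }
    (∫ x, |decaySol a q x|) fun F => ?_, fun F => rfl⟩
  change ‖∫ x, decaySol a q x * (expWeight η x * F x)‖ ≤ _
  rw [← integral_mul_const]
  refine norm_integral_le_of_norm_le (hφ.mul_const _) (Eventually.of_forall fun x => ?_)
  rw [norm_mul, norm_eq_abs, norm_eq_abs]
  exact mul_le_mul_of_nonneg_left (abs_expWeight_mul_le_norm hη F x) (abs_nonneg _)

lemma integral_decaySol_comp_neg (a q : ℝ) (f : ℝ → ℝ) :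
    ∫ x, decaySol a q x * f (-x) = -∫ x, decaySol a q x * f x := by
  rw [← integral_neg_eq_self (fun x => decaySol a q x * f x), ← integral_neg]
  congr 1; funext x
  rw [decaySol_neg]; ring

lemma integral_decaySol_mul_even (a q : ℝ) {f : ℝ → ℝ} (hf : ∀ x, f (-x) = f x) :
    ∫ x, decaySol a q x * f x = 0 := by
  have := integral_decaySol_comp_neg a q f
  simp only [hf] at this
  linarith

lemma integral_decaySol_sq_pos {a q : ℝ} (ha : 0 < a) (hq : 0 < q) :
    0 < ∫ x, decaySol a q x * decaySol a q x := by
  have hb : ∀ x, |decaySol a q x| ≤ 2 ^ q := fun x => (abs_decaySol_le ha hq x).trans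
    (mul_le_of_le_one_right (by positivity) (exp_neg_mul_abs_le_one (by positivity) x))
  refine integral_pos_of_integrable_nonneg_nonzero (x := 1)
    ((continuous_decaySol a q).mul (continuous_decaySol a q))
    (integrable_decaySol_mul ha hq (continuous_decaySol a q) hb) (fun x => mul_self_nonneg _) ?_
  have h1 : 0 < tanh (a * 1) := by
    rw [tanh_eq_sinh_div_cosh]
    exact div_pos (sinh_pos_iff.2 (by positivity)) (cosh_pos _)
  have : 0 < decaySol a q 1 := mul_pos (rpow_pos_of_pos (sech_pos _) q) h1
  positivity

/-- The kernel element in the weighted space. -/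
lemma exists_kernel {a q η : ℝ} (ha : 0 < a) (hq : 0 < q) (hηq : η ≤ a * q) :
    ∃ g : ℝ →ᵇ ℝ, ∀ x, expWeight η x * g x = decaySol a q x := by
  obtain ⟨g, hg, -⟩ := exists_boundedContinuous (η := η) (M := 2 ^ q) (continuous_decaySol a q)
    fun x => (abs_decaySol_le ha hq x).trans (by gcongr)
  exact ⟨g, hg⟩

/-- The Green operator as a bounded operator on the weighted space, precomposed with the projections off
the kernel and onto the functions of parity `σ`; the latter makes its values have parity `σ`. -/
lemma exists_weightedGreen {a q η σ : ℝ} (ha : 0 < a) (hq : 0 < q) (hη : 0 ≤ η) (hηq : η < a * q)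
    (hσ : σ * σ = 1) :
    ∃ K : (ℝ →ᵇ ℝ) →L[ℝ] (ℝ →ᵇ ℝ), (∀ F x, K F (-x) = σ * K F x) ∧
      ∀ F : ℝ →ᵇ ℝ, (∀ x, F (-x) = σ * F x) →
        ∫ x, decaySol a q x * (expWeight η x * F x) = 0 →
        ∀ x, expWeight η x * K F x = greenFn a q (fun y => expWeight η y * F y) x := by
  obtain ⟨C, hC, hbd⟩ := exists_greenFn_bound ha hq hη hηq
  obtain ⟨ℓ, hℓ⟩ := exists_pairing (η := η) ha hq hη
  obtain ⟨g, hg⟩ := exists_kernel ha hq hηq.le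
  have hℓg : ℓ g ≠ 0 := by
    rw [hℓ]; simp only [hg]; exact (integral_decaySol_sq_pos ha hq).ne'
  -- reflection
  let R : (ℝ →ᵇ ℝ) →L[ℝ] (ℝ →ᵇ ℝ) := LinearMap.mkContinuous
    { toFun := fun F => F.compContinuous ⟨fun x => -x, continuous_neg⟩
      map_add' := fun F G => rfl
      map_smul' := fun c F => rfl } 1 fun F => by
        rw [one_mul]
        exact (BoundedContinuousFunction.norm_le (norm_nonneg _)).2 fun x => abs_apply_le F (-x)
  have hR : ∀ F x, R F x = F (-x) := fun F x => rfl
  have hℓR : ∀ F, ℓ (R F) = -ℓ F := fun F => by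
    rw [hℓ, hℓ, ← integral_decaySol_comp_neg]
    simp only [hR, expWeight_neg]
  let P : (ℝ →ᵇ ℝ) →L[ℝ] (ℝ →ᵇ ℝ) :=
    ContinuousLinearMap.id ℝ _ - ((ℓ g)⁻¹ • ℓ).smulRight g
  have hP : ∀ F, P F = F - ((ℓ g)⁻¹ * ℓ F) • g := fun F => rfl
  have hℓP : ∀ F, ℓ (P F) = 0 := fun F => by
    rw [hP, map_sub, map_smul, smul_eq_mul]; field_simp; simp
  let S : (ℝ →ᵇ ℝ) →L[ℝ] (ℝ →ᵇ ℝ) :=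
    ((1 / 2 : ℝ) • (ContinuousLinearMap.id ℝ _ + σ • R)).comp P
  have hS : ∀ F, S F = (1 / 2 : ℝ) • (P F + σ • R (P F)) := fun F => rfl
  have hSx : ∀ F x, S F x = 1 / 2 * (P F x + σ * P F (-x)) := fun F x => rfl
  have hℓS : ∀ F, ∫ x, decaySol a q x * (expWeight η x * S F x) = 0 := fun F => by
    rw [← hℓ, hS, map_smul, map_add, map_smul, hℓR, hℓP]; simp
  have hSpar : ∀ F x, S F (-x) = σ * S F x := fun F x => by
    rw [hSx, hSx, neg_neg]; linear_combination (-1 / 2 * P F (-x)) * hσ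
  have hcont : ∀ F : ℝ →ᵇ ℝ, Continuous fun y => expWeight η y * S F y := fun F =>
    continuous_expWeight_mul η _
  have hb0 : ∀ F : ℝ →ᵇ ℝ, ∀ x, ‖(expWeight η x)⁻¹ * greenFn a q (fun y => expWeight η y * S F y) x‖ ≤
      C * ‖S F‖ := fun F x => by
    rw [norm_eq_abs, abs_mul, abs_of_pos (inv_pos.2 (expWeight_pos η x)),
      inv_mul_le_iff₀ (expWeight_pos η x), mul_comm]
    exact (hbd _ ‖S F‖ (hcont F) (abs_expWeight_mul_le η (S F)) (hℓS F) x).1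
  let T : (ℝ →ᵇ ℝ) → (ℝ →ᵇ ℝ) := fun F => BoundedContinuousFunction.ofNormedAddCommGroup
    (fun x => (expWeight η x)⁻¹ * greenFn a q (fun y => expWeight η y * S F y) x)
    (((continuous_expWeight η).inv₀ fun x => (expWeight_pos η x).ne').mul
      (continuous_greenFn a q (hcont F))) (C * ‖S F‖) (hb0 F)
  have hT : ∀ F x, T F x = (expWeight η x)⁻¹ * greenFn a q (fun y => expWeight η y * S F y) x :=
    fun F x => rfl
  let K : (ℝ →ᵇ ℝ) →L[ℝ] (ℝ →ᵇ ℝ) := LinearMap.mkContinuous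
    { toFun := T
      map_add' := fun F G => by
        ext x
        rw [BoundedContinuousFunction.add_apply, hT, hT, hT, ← mul_add,
          ← greenFn_add ha hq (hcont F) (hcont G) (abs_expWeight_mul_le_norm hη _)
            (abs_expWeight_mul_le_norm hη _)]
        simp only [map_add, BoundedContinuousFunction.add_apply, mul_add]
      map_smul' := fun c F => by
        ext x
        have e : (fun y => expWeight η y * S (c • F) y) = fun y => c * (expWeight η y * S F y) := by
          funext y
          rw [map_smul, BoundedContinuousFunction.smul_apply, smul_eq_mul, mul_left_comm]
        rw [RingHom.id_apply, BoundedContinuousFunction.smul_apply, hT, hT, smul_eq_mul, e,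
          greenFn_const_mul, mul_left_comm] }
    (C * ‖S‖) fun F => by
      refine (BoundedContinuousFunction.norm_ofNormedAddCommGroup_le _ (by positivity) (hb0 F)).trans ?_
      rw [mul_assoc]
      exact mul_le_mul_of_nonneg_left (S.le_opNorm F) hC.le
  have hK : ∀ F x, K F x = (expWeight η x)⁻¹ * greenFn a q (fun y => expWeight η y * S F y) x :=
    fun F x => rfl
  refine ⟨K, fun F x => ?_, fun F hF h0 x => ?_⟩
  · have e : (fun y => expWeight η (-y) * S F (-y)) = fun y => σ * (expWeight η y * S F y) := by
      funext y
      rw [expWeight_neg, hSpar, mul_left_comm]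
    rw [hK, hK, expWeight_neg, greenFn_neg ha hq (hcont F) (abs_expWeight_mul_le_norm hη _) (hℓS F),
      e, greenFn_const_mul, mul_left_comm]
  · have hPF : P F = F := by rw [hP, hℓ F, h0]; simp
    have hSF : S F = F := by
      ext y
      rw [hSx, hPF, hF]; linear_combination (1 / 2 * F y) * hσ
    rw [hK, hSF, mul_inv_cancel_left₀ (expWeight_pos η x).ne']

/-! ### Rescaled profiles -/

/-- The response `W` of the first component to the square of the kernel element; for `a = √c / 2` and
`q = expQ k` it is `L₁⁻¹ g̃²`. -/
def quadResponse (a q : ℝ) : ℝ → ℝ := greenFn a 2 fun y => decaySol a q y ^ 2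

/-- The profile equations after the rescaling `U = U₀ + t w`, `A = √t (φ + h)`, where `φ` is the decaying
solution and `ω` is the signed distance of `Ω` to the bifurcation point. The field `orth` is the solvability condition
of the second equation; for the first one solvability follows from parity. The Green operator `greenFn a q`
builds in the normalisation `h' 0 = 0`, which makes `√t` the amplitude of `A`. -/
structure IsProfile (a q k ω : ℝ) (w h : ℝ → ℝ) (t : ℝ) : Prop where
  cont_w : Continuous w
  cont_h : Continuous h
  even : ∀ x, w (-x) = w x
  odd : ∀ x, h (-x) = -h x
  eq_w : ∀ x, w x = greenFn a 2 (fun y => t / 2 * w y ^ 2 + (decaySol a q y + h y) ^ 2) x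
  orth : ∫ x, decaySol a q x * ((ω + k * t * w x) * (decaySol a q x + h x)) = 0
  eq_h : ∀ x, h x = greenFn a q (fun y => (ω + k * t * w y) * (decaySol a q y + h y)) x

/-- Zeros of the abstract bifurcation equation on the weighted space are the rescaled profiles. -/
lemma bifMap_eq_zero_iff {a q k η ω : ℝ} {ρ g : ℝ →ᵇ ℝ} {K₁ K₂ : (ℝ →ᵇ ℝ) →L[ℝ] (ℝ →ᵇ ℝ)}
    {ℓ : (ℝ →ᵇ ℝ) →L[ℝ] ℝ} (hρ : ∀ x, ρ x = expWeight η x)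
    (hg : ∀ x, expWeight η x * g x = decaySol a q x)
    (hℓ : ∀ F : ℝ →ᵇ ℝ, ℓ F = ∫ x, decaySol a q x * (expWeight η x * F x))
    (hK₁p : ∀ F x, K₁ F (-x) = 1 * K₁ F x)
    (hK₁ : ∀ F : ℝ →ᵇ ℝ, (∀ x, F (-x) = 1 * F x) →
      ∫ x, decaySol a 2 x * (expWeight η x * F x) = 0 →
        ∀ x, expWeight η x * K₁ F x = greenFn a 2 (fun y => expWeight η y * F y) x)
    (hK₂p : ∀ F x, K₂ F (-x) = -1 * K₂ F x)
    (hK₂ : ∀ F : ℝ →ᵇ ℝ, (∀ x, F (-x) = -1 * F x) →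
      ∫ x, decaySol a q x * (expWeight η x * F x) = 0 →
        ∀ x, expWeight η x * K₂ F x = greenFn a q (fun y => expWeight η y * F y) x)
    (w h : ℝ →ᵇ ℝ) (t : ℝ) :
    bifMap ρ g K₁ K₂ ℓ k ω (w, h, t) = 0 ↔
      IsProfile a q k ω (fun x => expWeight η x * w x) (fun x => expWeight η x * h x) t := by
  have hE : ∀ x, expWeight η x ≠ 0 := fun x => (expWeight_pos η x).ne'
  have hgodd : ∀ x, g (-x) = -g x := fun x => by
    have h1 := hg (-x)
    rw [decaySol_neg, ← hg, expWeight_neg, ← mul_neg] at h1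
    exact mul_left_cancel₀ (hE x) h1
  have hρe : ∀ x, ρ (-x) = ρ x := fun x => by rw [hρ, hρ, expWeight_neg]
  set F₁ : ℝ →ᵇ ℝ := (t / 2) • (ρ * w * w) + ρ * ((g + h) * (g + h)) with hF₁
  set F₂ : ℝ →ᵇ ℝ := bifSource ρ g k ω (w, h, t) with hF₂
  have hF₁x : ∀ x, F₁ x = t / 2 * (ρ x * w x * w x) + ρ x * ((g x + h x) * (g x + h x)) :=
    fun x => rfl
  have hF₂x : ∀ x, F₂ x = ω * (g x + h x) + k * t * (ρ x * w x * (g x + h x)) := fun x => rfl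
  have e₁ : (fun y => expWeight η y * F₁ y) = fun y => t / 2 * (expWeight η y * w y) ^ 2 +
      (decaySol a q y + expWeight η y * h y) ^ 2 := by
    funext y; rw [hF₁x, hρ, ← hg]; ring
  have e₂ : (fun y => expWeight η y * F₂ y) = fun y => (ω + k * t * (expWeight η y * w y)) *
      (decaySol a q y + expWeight η y * h y) := by
    funext y; rw [hF₂x, hρ, ← hg]; ring
  have hsys : bifMap ρ g K₁ K₂ ℓ k ω (w, h, t) = 0 ↔ w = K₁ F₁ ∧ h = K₂ F₂ ∧ ℓ F₂ = 0 := by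
    simp only [bifMap, ← hF₂, ← hF₁, Prod.mk_eq_zero, sub_eq_zero]
  rw [hsys]
  have hpar₁ : (∀ x, w (-x) = w x) → (∀ x, h (-x) = -h x) → ∀ x, F₁ (-x) = 1 * F₁ x :=
    fun hw hh x => by rw [hF₁x, hF₁x, hw, hh, hgodd, hρe]; ring
  have hpar₂ : (∀ x, w (-x) = w x) → (∀ x, h (-x) = -h x) → ∀ x, F₂ (-x) = -1 * F₂ x :=
    fun hw hh x => by rw [hF₂x, hF₂x, hw, hh, hgodd, hρe]; ring
  have horth₁ : (∀ x, F₁ (-x) = 1 * F₁ x) →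
      ∫ x, decaySol a 2 x * (expWeight η x * F₁ x) = 0 := fun h1 =>
    integral_decaySol_mul_even a 2 (f := fun x => expWeight η x * F₁ x) fun x => by
      rw [expWeight_neg, h1, one_mul]
  constructor
  · rintro ⟨h1, h2, h3⟩
    have hw : ∀ x, w (-x) = w x := fun x => by
      have := hK₁p F₁ x
      rwa [← h1, one_mul] at this
    have hh : ∀ x, h (-x) = -h x := fun x => by
      have := hK₂p F₂ x
      rwa [← h2, neg_one_mul] at this
    have horth₂ : ∫ x, decaySol a q x * (expWeight η x * F₂ x) = 0 := by rw [← hℓ, h3]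
    have s₁ := hK₁ F₁ (hpar₁ hw hh) (horth₁ (hpar₁ hw hh))
    have s₂ := hK₂ F₂ (hpar₂ hw hh) horth₂
    rw [← h1, e₁] at s₁
    rw [← h2, e₂] at s₂
    refine ⟨continuous_expWeight_mul η w, continuous_expWeight_mul η h,
      fun x => by simp only [expWeight_neg, hw], fun x => by simp only [expWeight_neg, hh, mul_neg],
      s₁, ?_, s₂⟩
    rw [← horth₂]
    congr 1; funext x
    rw [congrFun e₂ x]
  · intro hp
    have hw : ∀ x, w (-x) = w x := fun x => by
      have := hp.even x
      simp only [expWeight_neg] at this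
      exact mul_left_cancel₀ (hE x) this
    have hh : ∀ x, h (-x) = -h x := fun x => by
      have := hp.odd x
      simp only [expWeight_neg, ← mul_neg] at this
      exact mul_left_cancel₀ (hE x) this
    have horth₂ : ∫ x, decaySol a q x * (expWeight η x * F₂ x) = 0 := by
      rw [← hp.orth]
      congr 1; funext x
      rw [congrFun e₂ x]
    have s₁ := hK₁ F₁ (hpar₁ hw hh) (horth₁ (hpar₁ hw hh))
    have s₂ := hK₂ F₂ (hpar₂ hw hh) horth₂
    rw [e₁] at s₁
    rw [e₂] at s₂
    refine ⟨?_, ?_, by rw [hℓ, horth₂]⟩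
    · ext x
      exact mul_left_cancel₀ (hE x) ((hp.eq_w x).trans (s₁ x).symm)
    · ext x
      exact mul_left_cancel₀ (hE x) ((hp.eq_h x).trans (s₂ x).symm)

lemma decaySol_bound {a q : ℝ} (ha : 0 < a) (hq : 0 < q) (x : ℝ) : |decaySol a q x| ≤ 2 ^ q :=
  (abs_decaySol_le ha hq x).trans
    (mul_le_of_le_one_right (by positivity) (exp_neg_mul_abs_le_one (by positivity) x))

lemma decaySol_sq_le {a q η : ℝ} (ha : 0 < a) (hq : 0 < q) (hηq : η ≤ a * q) (x : ℝ) :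
    |decaySol a q x ^ 2| ≤ 2 ^ q * 2 ^ q * exp (-(η * |x|)) := by
  rw [pow_two, abs_mul]
  calc _ ≤ 2 ^ q * (2 ^ q * exp (-(a * q * |x|))) :=
        mul_le_mul (decaySol_bound ha hq x) (abs_decaySol_le ha hq x) (abs_nonneg _) (by positivity)
    _ ≤ 2 ^ q * (2 ^ q * exp (-(η * |x|))) := by gcongr
    _ = _ := by ring

lemma integral_decaySol_two_mul_sq (a q : ℝ) : ∫ x, decaySol a 2 x * decaySol a q x ^ 2 = 0 :=
  integral_decaySol_mul_even a 2 (f := fun x => decaySol a q x ^ 2) fun x => by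
    simp only [decaySol_neg, neg_sq]

/-- Existence and local uniqueness of rescaled profiles in the space with decay rate `η`, where `η = 0` is
allowed. -/
theorem profile_existsUnique {a q k η : ℝ} (ha : 0 < a) (hq : 0 < q) (hk : k ≠ 0) (hη : 0 ≤ η)
    (hη2 : η < a * 2) (hηq : η < a * q)
    (hQ : ∫ x, decaySol a q x ^ 2 * quadResponse a q x ≠ 0) :
    (∃ r > 0, ∀ ω : ℝ, |ω| < r → ∀ (w h w' h' : ℝ → ℝ) (t t' : ℝ), IsProfile a q k ω w h t →
      IsProfile a q k ω w' h' t' →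
      (∀ x, |w x - quadResponse a q x| ≤ r * exp (-(η * |x|))) →
      (∀ x, |h x| ≤ r * exp (-(η * |x|))) → |t| ≤ r →
      (∀ x, |w' x - quadResponse a q x| ≤ r * exp (-(η * |x|))) →
      (∀ x, |h' x| ≤ r * exp (-(η * |x|))) → |t'| ≤ r → w = w' ∧ h = h' ∧ t = t') ∧
    ∀ r > 0, ∃ δ > 0, ∀ ω : ℝ, |ω| < δ → ∃ (w h : ℝ → ℝ) (t : ℝ), IsProfile a q k ω w h t ∧
      (∀ x, |w x - quadResponse a q x| ≤ r * exp (-(η * |x|))) ∧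
      (∀ x, |h x| ≤ r * exp (-(η * |x|))) ∧ |t| ≤ r := by
  obtain ⟨ρ, hρ, -⟩ := exists_boundedContinuous (η := 0) (M := 1) (continuous_expWeight η)
    fun x => by
      rw [abs_of_pos (expWeight_pos η x)]; simpa using expWeight_le_one hη x
  simp only [expWeight_zero, one_mul] at hρ
  obtain ⟨g, hg⟩ := exists_kernel (η := η) ha hq hηq.le
  obtain ⟨ℓ, hℓ⟩ := exists_pairing (η := η) ha hq hη
  obtain ⟨K₁, hK₁p, hK₁⟩ := exists_weightedGreen (σ := 1) ha two_pos hη hη2 (by norm_num)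
  obtain ⟨K₂, hK₂p, hK₂⟩ := exists_weightedGreen (σ := -1) ha hq hη hηq (by norm_num)
  have hE : ∀ x, expWeight η x ≠ 0 := fun x => (expWeight_pos η x).ne'
  have hgg : (fun y => expWeight η y * (ρ * (g * g)) y) = fun y => decaySol a q y ^ 2 := by
    funext y
    rw [BoundedContinuousFunction.mul_apply, BoundedContinuousFunction.mul_apply, hρ, ← hg]; ring
  set W : ℝ →ᵇ ℝ := K₁ (ρ * (g * g)) with hW
  have hWx : ∀ x, expWeight η x * W x = quadResponse a q x := by
    intro x
    rw [hW, hK₁, hgg, quadResponse]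
    · intro y
      refine mul_left_cancel₀ (hE y) ?_
      have h1 := congrFun hgg (-y)
      simp only [expWeight_neg, decaySol_neg, neg_sq] at h1
      rw [h1, one_mul]
      exact (congrFun hgg y).symm
    · have : (fun x => decaySol a 2 x * (expWeight η x * (ρ * (g * g)) x)) =
          fun x => decaySol a 2 x * decaySol a q x ^ 2 := by
        funext y; rw [congrFun hgg y]
      rw [this, integral_decaySol_two_mul_sq]
  have hQ' : ℓ (ρ * W * g) ≠ 0 := by
    rw [hℓ]
    convert hQ using 2
    funext x
    rw [BoundedContinuousFunction.mul_apply, BoundedContinuousFunction.mul_apply, hρ, ← hWx, ← hg]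
    ring
  have hiff := fun ω => bifMap_eq_zero_iff (k := k) (ω := ω) hρ hg hℓ hK₁p hK₁ hK₂p hK₂
  obtain ⟨⟨r₀, hr₀, huniq⟩, hex⟩ := bifMap_existsUnique ρ g K₁ K₂ ℓ hk hW hQ'
  constructor
  · refine ⟨r₀ / 2, by positivity, fun ω hω w h w' h' t t' hp hp' b1 b2 b3 b1' b2' b3' => ?_⟩
    have rep : ∀ (w h : ℝ → ℝ) (t : ℝ), IsProfile a q k ω w h t →
        (∀ x, |w x - quadResponse a q x| ≤ r₀ / 2 * exp (-(η * |x|))) →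
        (∀ x, |h x| ≤ r₀ / 2 * exp (-(η * |x|))) → |t| ≤ r₀ / 2 →
        ∃ w₁ h₁ : ℝ →ᵇ ℝ, w = (fun x => expWeight η x * w₁ x) ∧ h = (fun x => expWeight η x * h₁ x) ∧
          (w₁, h₁, t) ∈ Metric.ball (W, (0 : ℝ →ᵇ ℝ), (0 : ℝ)) r₀ := by
      intro w h t hp b1 b2 b3
      have hWc : Continuous (quadResponse a q) :=
        continuous_greenFn a 2 ((continuous_decaySol a q).pow 2)
      obtain ⟨w₁, hw₁, hn₁⟩ := exists_boundedContinuous (hp.cont_w.sub hWc) b1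
      obtain ⟨h₁, hh₁, hn₂⟩ := exists_boundedContinuous hp.cont_h b2
      refine ⟨W + w₁, h₁, ?_, ?_, ?_⟩
      · funext x; rw [BoundedContinuousFunction.add_apply, mul_add, hWx, hw₁, Pi.sub_apply]; ring
      · funext x; rw [hh₁]
      · rw [Metric.mem_ball, Prod.dist_eq, Prod.dist_eq, max_lt_iff, max_lt_iff]
        refine ⟨?_, ?_, ?_⟩
        · rw [dist_eq_norm, add_sub_cancel_left]; linarith
        · rw [dist_zero_right]; linarith
        · rw [dist_zero_right, norm_eq_abs]; linarith
    obtain ⟨w₁, h₁, rfl, rfl, hm⟩ := rep w h t hp b1 b2 b3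
    obtain ⟨w₂, h₂, rfl, rfl, hm'⟩ := rep w' h' t' hp' b1' b2' b3'
    have := huniq ω (by linarith) _ hm _ hm' ((hiff ω _ _ _).2 hp) ((hiff ω _ _ _).2 hp')
    simp only [Prod.mk.injEq] at this
    obtain ⟨rfl, rfl, rfl⟩ := this
    exact ⟨rfl, rfl, rfl⟩
  · intro r hr
    obtain ⟨δ, hδ, hsol⟩ := hex r hr
    refine ⟨δ, hδ, fun ω hω => ?_⟩
    obtain ⟨⟨w, h, t⟩, hm, h0⟩ := hsol ω hω
    rw [Metric.mem_ball, Prod.dist_eq, Prod.dist_eq, max_lt_iff, max_lt_iff, dist_zero_right,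
      dist_zero_right, norm_eq_abs, dist_eq_norm] at hm
    refine ⟨_, _, t, (hiff ω w h t).1 h0, fun x => ?_, fun x => ?_, hm.2.2.le⟩
    · rw [← hWx, ← mul_sub, ← BoundedContinuousFunction.sub_apply]
      exact (abs_expWeight_mul_le η _ x).trans
        (mul_le_mul_of_nonneg_right hm.1.le (exp_pos _).le)
    · exact (abs_expWeight_mul_le η _ x).trans
        (mul_le_mul_of_nonneg_right hm.2.1.le (exp_pos _).le)

/-! ### Decay of the second derivatives -/

lemma continuous_potential (a q : ℝ) : Continuous (potential a q) := by
  have h : Continuous fun x => sech (a * x) ^ 2 :=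
    continuous_iff_continuousAt.2 fun x => (hasDerivAt_sech_sq a x).continuousAt
  unfold potential
  fun_prop

lemma abs_potential_le {q : ℝ} (a : ℝ) (hq : 0 < q) (x : ℝ) :
    |potential a q x| ≤ a ^ 2 * (q ^ 2 + (q + 1) * (q + 2)) := by
  have h0 := sech_pos (a * x)
  have h1 : sech (a * x) ^ 2 ≤ 1 := by nlinarith [sech_le_one (a * x)]
  rw [potential, abs_mul, abs_of_nonneg (sq_nonneg a)]
  refine mul_le_mul_of_nonneg_left ?_ (sq_nonneg a)
  have h2 : (q + 1) * (q + 2) * sech (a * x) ^ 2 ≤ (q + 1) * (q + 2) :=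
    mul_le_of_le_one_right (by positivity) h1
  have h3 : 0 ≤ (q + 1) * (q + 2) * sech (a * x) ^ 2 := by positivity
  rw [abs_le]
  constructor <;> nlinarith [sq_nonneg q]

/-- Decay of `greenFn a q f` with its first two derivatives. -/
lemma exists_greenFn_decay {a q η : ℝ} (ha : 0 < a) (hq : 0 < q) (hη : 0 ≤ η) (hηq : η < a * q) :
    ∃ C > 0, ∀ (f : ℝ → ℝ) (M : ℝ), Continuous f → (∀ x, |f x| ≤ M * exp (-(η * |x|))) →
      ∫ x, decaySol a q x * f x = 0 → ∀ x,
        |greenFn a q f x| ≤ C * M * exp (-(η * |x|)) ∧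
        |greenFnDeriv a q f x| ≤ C * M * exp (-(η * |x|)) ∧
        |potential a q x * greenFn a q f x - f x| ≤ C * M * exp (-(η * |x|)) := by
  obtain ⟨C, hC, hb⟩ := exists_greenFn_bound ha hq hη hηq
  set B := a ^ 2 * (q ^ 2 + (q + 1) * (q + 2)) with hB
  have hB0 : 0 < B := by positivity
  refine ⟨C + (B * C + 1), by positivity, fun f M hf hM h0 x => ?_⟩
  have hM0 : 0 ≤ M := by simpa using (abs_nonneg _).trans (hM 0)
  obtain ⟨h1, h2⟩ := hb f M hf hM h0 x
  have hE : 0 ≤ M * exp (-(η * |x|)) := by positivity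
  have h3 : |potential a q x * greenFn a q f x - f x| ≤ (B * C + 1) * (M * exp (-(η * |x|))) := by
    refine (abs_sub _ _).trans ?_
    rw [abs_mul]
    have := mul_le_mul (abs_potential_le a hq x) h1 (abs_nonneg _) hB0.le
    rw [← hB] at this
    linarith [hM x]
  have h4 : 0 ≤ C * (M * exp (-(η * |x|))) := by positivity
  have h5 : 0 ≤ (B * C + 1) * (M * exp (-(η * |x|))) := by positivity
  refine ⟨?_, ?_, ?_⟩ <;> linarith

lemma exists_decaySol_decay {a q η : ℝ} (ha : 0 < a) (hq : 0 < q) (hηq : η ≤ a * q) :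
    ∃ C > 0, ∀ x, |decaySol a q x| ≤ C * exp (-(η * |x|)) ∧
      |decaySolDeriv a q x| ≤ C * exp (-(η * |x|)) ∧
      |potential a q x * decaySol a q x| ≤ C * exp (-(η * |x|)) := by
  set B := a ^ 2 * (q ^ 2 + (q + 1) * (q + 2)) with hB
  have hB0 : 0 < B := by positivity
  have hΦ : (0 : ℝ) < 2 ^ q := by positivity
  refine ⟨2 ^ q + (a * (q + 1) * 2 ^ q + B * 2 ^ q), by positivity, fun x => ?_⟩
  have he : exp (-(a * q * |x|)) ≤ exp (-(η * |x|)) := by gcongr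
  set E := exp (-(η * |x|)) with hEdef
  have hE : 0 < E := exp_pos _
  have h1 : |decaySol a q x| ≤ 2 ^ q * E := (abs_decaySol_le ha hq x).trans (by gcongr)
  have h2 : |decaySolDeriv a q x| ≤ a * (q + 1) * 2 ^ q * E :=
    (abs_decaySolDeriv_le ha hq x).trans (by gcongr)
  have h3 : |potential a q x * decaySol a q x| ≤ B * (2 ^ q * E) := by
    rw [abs_mul]; exact mul_le_mul (abs_potential_le a hq x) h1 (abs_nonneg _) hB0.le
  have p1 : 0 < 2 ^ q * E := by positivity
  have p2 : 0 < a * (q + 1) * 2 ^ q * E := by positivity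
  have p3 : 0 < B * (2 ^ q * E) := by positivity
  refine ⟨?_, ?_, ?_⟩ <;> linarith

/-! ### The soliton -/

/-- The derivative of `soliton`. -/
def solitonDeriv (c x : ℝ) : ℝ :=
  -(3 * c * sqrt c * sech (sqrt c / 2 * x) ^ 2 * tanh (sqrt c / 2 * x))

lemma hasDerivAt_soliton (c x : ℝ) : HasDerivAt (soliton c) (solitonDeriv c x) x := by
  refine ((hasDerivAt_sech_sq (sqrt c / 2) x).const_mul (3 * c)).congr_deriv ?_
  rw [solitonDeriv]; ring

lemma hasDerivAt_solitonDeriv {c : ℝ} (hc : 0 ≤ c) (x : ℝ) :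
    HasDerivAt (solitonDeriv c) (c * soliton c x - 1 / 2 * soliton c x ^ 2) x := by
  have h := (((hasDerivAt_sech_sq (sqrt c / 2) x).const_mul (3 * c * sqrt c)).mul
    (hasDerivAt_tanh_mul (sqrt c / 2) x)).neg
  refine h.congr_deriv ?_
  simp only [soliton]
  have hT := tanh_sq_eq (sqrt c / 2 * x)
  have hs := sq_sqrt hc
  set s := sech (sqrt c / 2 * x)
  set T := tanh (sqrt c / 2 * x)
  linear_combination (3 * c * sqrt c ^ 2 * s ^ 2) * hT + (3 * c * s ^ 2 - 9 / 2 * c * s ^ 4) * hs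

lemma continuous_soliton (c : ℝ) : Continuous (soliton c) :=
  continuous_iff_continuousAt.2 fun x => (hasDerivAt_soliton c x).continuousAt

lemma soliton_neg (c x : ℝ) : soliton c (-x) = soliton c x := by
  simp [soliton, sech_neg]

lemma potential_two {c : ℝ} (hc : 0 ≤ c) (x : ℝ) : potential (sqrt c / 2) 2 x = c - soliton c x := by
  simp only [potential, soliton]
  linear_combination (1 - 3 * sech (sqrt c / 2 * x) ^ 2) * sq_sqrt hc

lemma expQ_pos {k : ℝ} (hk : 1 / 6 < k) : 0 < expQ k := by
  have : (3 : ℝ) < sqrt (1 + 48 * k) := by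
    rw [lt_sqrt (by norm_num)]; linarith
  unfold expQ; linarith

lemma expQ_mul {k : ℝ} (hk : 1 / 6 < k) : (expQ k + 1) * (expQ k + 2) = 12 * k := by
  have := sq_sqrt (show 0 ≤ 1 + 48 * k by linarith)
  unfold expQ; linear_combination this / 4

lemma omegaC_eq {c : ℝ} (hc : 0 ≤ c) (k : ℝ) : omegaC c k = -((sqrt c / 2) ^ 2 * expQ k ^ 2) := by
  unfold omegaC expQ
  linear_combination ((sqrt (1 + 48 * k) - 3) ^ 2 / 16) * sq_sqrt hc

lemma potential_expQ {c k : ℝ} (hc : 0 ≤ c) (hk : 1 / 6 < k) (x : ℝ) :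
    potential (sqrt c / 2) (expQ k) x = -omegaC c k - k * soliton c x := by
  rw [omegaC_eq hc, potential, soliton]
  linear_combination (-(sqrt c / 2) ^ 2 * sech (sqrt c / 2 * x) ^ 2) * expQ_mul hk -
    3 * k * sech (sqrt c / 2 * x) ^ 2 * sq_sqrt hc

lemma gTilde_eq (c k : ℝ) : gTilde c k = decaySol (sqrt c / 2) (expQ k) := rfl

lemma memH2_soliton {c : ℝ} (hc : 0 < c) : MemH2 (soliton c) := by
  have hsc : 0 < sqrt c := sqrt_pos.2 hc
  have hb : ∀ x, sech (sqrt c / 2 * x) ^ 2 ≤ 4 * exp (-(sqrt c * |x|)) := fun x => by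
    have h := sech_rpow_le (q := 2) (by norm_num) (sqrt c / 2 * x)
    simp only [rpow_ofNat] at h
    refine h.trans (le_of_eq ?_)
    rw [abs_mul, abs_of_pos (by positivity : 0 < sqrt c / 2)]
    norm_num; ring
  have h1 : ∀ x, |soliton c x| ≤ 3 * c * (4 * exp (-(sqrt c * |x|))) := fun x => by
    rw [soliton, abs_of_nonneg (by positivity)]
    exact mul_le_mul_of_nonneg_left (hb x) (by positivity)
  have hle : ∀ x, |soliton c x| ≤ 3 * c := fun x => by
    rw [soliton, abs_of_nonneg (by positivity)]
    refine mul_le_of_le_one_right (by positivity) ?_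
    nlinarith [sech_le_one (sqrt c / 2 * x), sech_pos (sqrt c / 2 * x)]
  have h2 : ∀ x, |solitonDeriv c x| ≤ 3 * c * sqrt c * (4 * exp (-(sqrt c * |x|))) := fun x => by
    rw [solitonDeriv, abs_neg, abs_mul, abs_of_nonneg (by positivity)]
    calc _ ≤ 3 * c * sqrt c * (4 * exp (-(sqrt c * |x|))) * 1 := by
          gcongr
          · exact hb x
          · exact abs_tanh_le_one _
      _ = _ := mul_one _
  have h3 : ∀ x, |c * soliton c x - 1 / 2 * soliton c x ^ 2| ≤
      3 * c * (3 * c) * (4 * exp (-(sqrt c * |x|))) := fun x => by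
    have e : c * soliton c x - 1 / 2 * soliton c x ^ 2 = (c - 1 / 2 * soliton c x) * soliton c x := by
      ring
    have h4 : |c - 1 / 2 * soliton c x| ≤ 3 * c := by
      have := abs_le.1 (hle x)
      rw [abs_le]; constructor <;> linarith
    rw [e, abs_mul]
    calc _ ≤ 3 * c * (3 * c * (4 * exp (-(sqrt c * |x|)))) :=
          mul_le_mul h4 (h1 x) (abs_nonneg _) (by positivity)
      _ = _ := by ring
  have hcont := continuous_soliton c
  refine (memH2_of_decay (M := (3 * c + (3 * c * sqrt c + 3 * c * (3 * c))) * 4) hsc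
    (hasDerivAt_soliton c) (hasDerivAt_solitonDeriv hc.le) (by fun_prop) (fun x => ?_) (fun x => ?_)
    fun x => ?_).1
  · refine (h1 x).trans ?_
    rw [mul_assoc (_ + _)]
    refine mul_le_mul_of_nonneg_right ?_ (by positivity)
    have : 0 ≤ 3 * c * sqrt c + 3 * c * (3 * c) := by positivity
    linarith
  · refine (h2 x).trans ?_
    rw [mul_assoc (_ + _)]
    refine mul_le_mul_of_nonneg_right ?_ (by positivity)
    have : 0 ≤ 3 * c * (3 * c) := by positivity
    linarith
  · refine (h3 x).trans ?_
    rw [mul_assoc (_ + _)]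
    refine mul_le_mul_of_nonneg_right ?_ (by positivity)
    have : 0 ≤ 3 * c * sqrt c := by positivity
    linarith

/-! ### Sums and differences in `H²` -/

lemma IsWeakDeriv.add {f g f' g' : ℝ → ℝ} (h : IsWeakDeriv f f') (h' : IsWeakDeriv g g') :
    IsWeakDeriv (fun x => f x + g x) (fun x => f' x + g' x) := by
  refine ⟨h.1.add h'.1, h.2.1.add h'.2.1, fun φ hφ hφc => ?_⟩
  have hd : Continuous (deriv φ) := hφ.continuous_deriv (by exact_mod_cast le_top)
  simp only [add_mul]
  rw [integral_add (integrable_mul_test h.1 hd hφc.deriv) (integrable_mul_test h'.1 hd hφc.deriv),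
    integral_add (integrable_mul_test h.2.1 hφ.continuous hφc)
      (integrable_mul_test h'.2.1 hφ.continuous hφc), h.2.2 φ hφ hφc, h'.2.2 φ hφ hφc]
  ring

lemma IsWeakDeriv.neg {f f' : ℝ → ℝ} (h : IsWeakDeriv f f') :
    IsWeakDeriv (fun x => -f x) (fun x => -f' x) := by
  refine ⟨h.1.neg, h.2.1.neg, fun φ hφ hφc => ?_⟩
  simp only [neg_mul, integral_neg, h.2.2 φ hφ hφc]

lemma MemH2.add {f g : ℝ → ℝ} (hf : MemH2 f) (hg : MemH2 g) : MemH2 fun x => f x + g x := by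
  obtain ⟨f₁, f₂, h1, h2, m0, m1, m2⟩ := hf
  obtain ⟨g₁, g₂, h1', h2', m0', m1', m2'⟩ := hg
  exact ⟨_, _, h1.add h1', h2.add h2', m0.add m0', m1.add m1', m2.add m2'⟩

lemma MemH2.neg {f : ℝ → ℝ} (hf : MemH2 f) : MemH2 fun x => -f x := by
  obtain ⟨f₁, f₂, h1, h2, m0, m1, m2⟩ := hf
  exact ⟨_, _, h1.neg, h2.neg, m0.neg, m1.neg, m2.neg⟩

lemma MemH2.weakDeriv_weakDeriv_sub {f g : ℝ → ℝ} (hf : MemH2 f) (hg : MemH2 g) :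
    MemH2 (fun x => f x - g x) ∧ weakDeriv (weakDeriv fun x => f x - g x) =ᵐ[volume]
      fun x => weakDeriv (weakDeriv f) x - weakDeriv (weakDeriv g) x := by
  have hm := hf.add hg.neg
  obtain ⟨f₁, f₂, h1, h2, m0, m1, m2⟩ := hf
  obtain ⟨g₁, g₂, h1', h2', m0', m1', m2'⟩ := hg
  have e : (fun x => f x - g x) = fun x => f x + -g x := by funext x; ring
  rw [e]
  refine ⟨hm, ?_⟩
  filter_upwards [(h1.add h1'.neg).weakDeriv_weakDeriv_ae_eq (h2.add h2'.neg),
    h1.weakDeriv_weakDeriv_ae_eq h2, h1'.weakDeriv_weakDeriv_ae_eq h2'] with x a1 a2 a3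
  rw [a1, a2, a3]; ring

/-! ### From profiles to solutions -/

/-- A decaying rescaled profile yields a solution of the system, with norm bounds that are linear in the
amplitude `s` and in `s²`. -/
lemma exists_solution_of_profile {c k η N : ℝ} (hc : 0 < c) (hk : 1 / 6 < k) (hη : 0 < η)
    (hη2 : η < sqrt c / 2 * 2) (hηq : η < sqrt c / 2 * expQ k) (hN : 0 < N) :
    ∃ C > 0, ∀ (ω s : ℝ) (w h : ℝ → ℝ), |ω| ≤ 1 → s ^ 2 ≤ 1 →
      IsProfile (sqrt c / 2) (expQ k) k ω w h (s ^ 2) →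
      (∀ x, |w x| ≤ N * exp (-(η * |x|))) → (∀ x, |h x| ≤ N * exp (-(η * |x|))) →
      MemH2Even (fun x => soliton c x + s ^ 2 * w x) ∧
      MemH2Odd (fun x => s * (gTilde c k x + h x)) ∧
      SolvesSystem c k 1 (omegaC c k + ω) (fun x => soliton c x + s ^ 2 * w x)
        (fun x => s * (gTilde c k x + h x)) ∧
      h2Norm (fun x => (soliton c x + s ^ 2 * w x) - soliton c x) ≤ C * s ^ 2 ∧
      h2Norm (fun x => s * (gTilde c k x + h x)) ≤ C * |s| := by
  have hq := expQ_pos hk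
  have hk0 : 0 < k := by linarith
  simp only [gTilde_eq]
  set q := expQ k with hqdef
  set a := sqrt c / 2 with hadef
  have ha : 0 < a := by have := sqrt_pos.2 hc; positivity
  obtain ⟨C₁, hC₁, hb₁⟩ := exists_greenFn_decay ha two_pos hη.le hη2
  obtain ⟨C₂, hC₂, hb₂⟩ := exists_greenFn_decay ha hq hη.le hηq
  obtain ⟨D, hD, hbD⟩ := exists_decaySol_decay (η := η) ha hq hηq.le
  set J := sqrt (3 * ∫ x, exp (-(2 * η * |x|))) with hJ
  have hJ0 : 0 ≤ J := sqrt_nonneg _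
  set M₁ := N * N / 2 + (D + N) * (D + N) with hM₁
  set M₂ := (1 + k * N) * (D + N) with hM₂
  refine ⟨C₁ * M₁ * J + (D + C₂ * M₂) * J + 1, by positivity, fun ω s w h hω hs hp hw hh => ?_⟩
  have hEle : ∀ x : ℝ, exp (-(η * |x|)) ≤ 1 := exp_neg_mul_abs_le_one hη.le
  have hgh : ∀ x, |decaySol a q x + h x| ≤ (D + N) * exp (-(η * |x|)) := fun x => by
    refine (abs_add_le _ _).trans ?_
    linarith [(hbD x).1, hh x]
  have hgh' : ∀ x, |decaySol a q x + h x| ≤ D + N := fun x =>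
    (hgh x).trans (mul_le_of_le_one_right (by positivity) (hEle x))
  have hw' : ∀ x, |w x| ≤ N := fun x => (hw x).trans (mul_le_of_le_one_right hN.le (hEle x))
  have hs0 : 0 ≤ s ^ 2 := sq_nonneg s
  have hcw := hp.cont_w
  have hch := hp.cont_h
  have hcφ := continuous_decaySol a q
  obtain ⟨f₁, hf₁⟩ : ∃ f₁ : ℝ → ℝ, f₁ = fun y => s ^ 2 / 2 * w y ^ 2 + (decaySol a q y + h y) ^ 2 :=
    ⟨_, rfl⟩
  obtain ⟨f₂, hf₂⟩ : ∃ f₂ : ℝ → ℝ, f₂ = fun y => (ω + k * s ^ 2 * w y) * (decaySol a q y + h y) :=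
    ⟨_, rfl⟩
  have hf₁c : Continuous f₁ := by rw [hf₁]; fun_prop
  have hf₂c : Continuous f₂ := by rw [hf₂]; fun_prop
  have hf₁b : ∀ x, |f₁ x| ≤ M₁ * exp (-(η * |x|)) := fun x => by
    rw [hf₁]
    refine (abs_add_le _ _).trans ?_
    have e1 : |s ^ 2 / 2 * w x ^ 2| ≤ N * N / 2 * exp (-(η * |x|)) := by
      rw [abs_mul, pow_two (w x), abs_mul, abs_of_nonneg (by positivity)]
      calc _ ≤ 1 / 2 * (N * (N * exp (-(η * |x|)))) := by
            refine mul_le_mul (by linarith)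
              (mul_le_mul (hw' x) (hw x) (abs_nonneg _) hN.le) (by positivity) (by norm_num)
        _ = _ := by ring
    have e2 : |(decaySol a q x + h x) ^ 2| ≤ (D + N) * (D + N) * exp (-(η * |x|)) := by
      rw [pow_two, abs_mul, mul_assoc]
      exact mul_le_mul (hgh' x) (hgh x) (abs_nonneg _) (by positivity)
    rw [hM₁, add_mul]
    exact add_le_add e1 e2
  have hf₂b : ∀ x, |f₂ x| ≤ M₂ * exp (-(η * |x|)) := fun x => by
    rw [hf₂, hM₂]
    simp only
    rw [abs_mul, mul_assoc (1 + k * N)]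
    refine mul_le_mul ((abs_add_le _ _).trans ?_) (hgh x) (abs_nonneg _) (by positivity)
    refine add_le_add hω ?_
    rw [abs_mul, abs_of_nonneg (by positivity : 0 ≤ k * s ^ 2)]
    refine mul_le_mul ?_ (hw' x) (abs_nonneg _) hk0.le
    exact mul_le_of_le_one_right hk0.le hs
  have hw_eq : w = greenFn a 2 f₁ := by rw [hf₁]; exact funext hp.eq_w
  have hh_eq : h = greenFn a q f₂ := by rw [hf₂]; exact funext hp.eq_h
  have horth₁ : ∫ x, decaySol a 2 x * f₁ x = 0 := integral_decaySol_mul_even a 2 fun x => by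
    simp only [hf₁, hp.even, hp.odd, decaySol_neg]; ring
  have horth₂ : ∫ x, decaySol a q x * f₂ x = 0 := by rw [hf₂]; exact hp.orth
  have dw : ∀ x, HasDerivAt w (greenFnDeriv a 2 f₁ x) x := fun x => by
    have := hasDerivAt_greenFn a 2 hf₁c x
    rwa [← hw_eq] at this
  have dw₁ : ∀ x, HasDerivAt (greenFnDeriv a 2 f₁) (potential a 2 x * w x - f₁ x) x := fun x => by
    have := hasDerivAt_greenFnDeriv ha.ne' 2 hf₁c x
    rwa [← hw_eq] at this
  have dh : ∀ x, HasDerivAt h (greenFnDeriv a q f₂ x) x := fun x => by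
    have := hasDerivAt_greenFn a q hf₂c x
    rwa [← hh_eq] at this
  have dh₁ : ∀ x, HasDerivAt (greenFnDeriv a q f₂) (potential a q x * h x - f₂ x) x := fun x => by
    have := hasDerivAt_greenFnDeriv ha.ne' q hf₂c x
    rwa [← hh_eq] at this
  have bw := hb₁ f₁ M₁ hf₁c hf₁b horth₁
  have bh := hb₂ f₂ M₂ hf₂c hf₂b horth₂
  rw [← hw_eq] at bw
  rw [← hh_eq] at bh
  have cV2 := continuous_potential a 2
  have cVq := continuous_potential a q
  have scale : ∀ y B r x : ℝ, |y| ≤ B * exp (-(η * |x|)) → |r * y| ≤ |r| * B * exp (-(η * |x|)) :=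
    fun y B r x hy => by
      rw [abs_mul, mul_assoc]; exact mul_le_mul_of_nonneg_left hy (abs_nonneg r)
  -- the correction to the soliton
  have dz : ∀ x, HasDerivAt (fun x => s ^ 2 * w x) (s ^ 2 * greenFnDeriv a 2 f₁ x) x := fun x =>
    (dw x).const_mul _
  have dz₁ : ∀ x, HasDerivAt (fun x => s ^ 2 * greenFnDeriv a 2 f₁ x)
      (s ^ 2 * (potential a 2 x * w x - f₁ x)) x := fun x => (dw₁ x).const_mul _
  have cz₂ : Continuous fun x => s ^ 2 * (potential a 2 x * w x - f₁ x) := by fun_prop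
  have hz := memH2_of_decay hη dz dz₁ cz₂ (fun x => scale _ _ _ x (bw x).1)
    (fun x => scale _ _ _ x (bw x).2.1) (fun x => scale _ _ _ x (bw x).2.2)
  -- the second component
  have dA : ∀ x, HasDerivAt (fun x => s * (decaySol a q x + h x))
      (s * (decaySolDeriv a q x + greenFnDeriv a q f₂ x)) x := fun x =>
    ((hasDerivAt_decaySol a q x).add (dh x)).const_mul s
  have dA₁ : ∀ x, HasDerivAt (fun x => s * (decaySolDeriv a q x + greenFnDeriv a q f₂ x))
      (s * (potential a q x * decaySol a q x + (potential a q x * h x - f₂ x))) x := fun x =>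
    ((hasDerivAt_decaySolDeriv a q x).add (dh₁ x)).const_mul s
  have cA₂ : Continuous fun x =>
      s * (potential a q x * decaySol a q x + (potential a q x * h x - f₂ x)) := by fun_prop
  have sum : ∀ y z x : ℝ, |y| ≤ D * exp (-(η * |x|)) → |z| ≤ C₂ * M₂ * exp (-(η * |x|)) →
      |y + z| ≤ (D + C₂ * M₂) * exp (-(η * |x|)) := fun y z x hy hz => by
    refine (abs_add_le _ _).trans ?_
    linarith
  have hA := memH2_of_decay hη dA dA₁ cA₂
    (fun x => scale _ _ _ x (sum _ _ x (hbD x).1 (bh x).1))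
    (fun x => scale _ _ _ x (sum _ _ x (hbD x).2.1 (bh x).2.1))
    (fun x => scale _ _ _ x (sum _ _ x (hbD x).2.2 (bh x).2.2))
  have wU := weakDeriv_weakDeriv_ae_eq_of_hasDerivAt
    (u := fun x => soliton c x + s ^ 2 * w x) (fun x => (hasDerivAt_soliton c x).add (dz x))
    (fun x => (hasDerivAt_solitonDeriv hc.le x).add (dz₁ x))
    (by have := continuous_soliton c; fun_prop)
  have wA := weakDeriv_weakDeriv_ae_eq_of_hasDerivAt dA dA₁ cA₂
  refine ⟨⟨(memH2_soliton hc).add hz.1, Eventually.of_forall fun x => ?_⟩,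
    ⟨hA.1, Eventually.of_forall fun x => ?_⟩, ⟨?_, ?_⟩, ?_, ?_⟩
  · simp only [soliton_neg, hp.even]
  · simp only [decaySol_neg, hp.odd]; ring
  · filter_upwards [wU] with x hx
    rw [hx, hadef, potential_two hc.le, ← hadef, hf₁]
    ring
  · filter_upwards [wA] with x hx
    rw [hx, hadef, hqdef, potential_expQ hc.le hk, ← hadef, ← hqdef, hf₂]
    ring
  · simp only [add_sub_cancel_left]
    refine hz.2.trans ?_
    rw [abs_of_nonneg hs0]
    have : 0 ≤ (D + C₂ * M₂) * J + 1 := by positivity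
    nlinarith [mul_nonneg this hs0]
  · refine hA.2.trans ?_
    have : 0 ≤ C₁ * M₁ * J + 1 := by positivity
    nlinarith [mul_nonneg this (abs_nonneg s)]

/-! ### The amplitude -/

lemma continuous_quadResponse (a q : ℝ) : Continuous (quadResponse a q) :=
  continuous_greenFn a 2 ((continuous_decaySol a q).pow 2)

lemma exists_quadResponse_bound {a q η : ℝ} (ha : 0 < a) (hq : 0 < q) (hη : 0 ≤ η)
    (hη2 : η < a * 2) (hηq : η ≤ a * q) :
    ∃ B > 0, ∀ x, |quadResponse a q x| ≤ B * exp (-(η * |x|)) := by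
  obtain ⟨C, hC, hb⟩ := exists_greenFn_bound ha two_pos hη hη2
  refine ⟨C * (2 ^ q * 2 ^ q), by positivity, fun x => ?_⟩
  exact (hb _ _ ((continuous_decaySol a q).pow 2) (decaySol_sq_le ha hq hηq)
    (integral_decaySol_two_mul_sq a q) x).1

/-- The solvability condition determines `t` in terms of `ω`: to leading order
`t = -ω ∫ φ² / (k ∫ φ² L₁⁻¹ φ²)`, which fixes the side of the bifurcation. -/
lemma exists_amplitude_bound {a q k : ℝ} (ha : 0 < a) (hq : 0 < q) (hk : 0 < k)
    (hQ : ∫ x, decaySol a q x ^ 2 * quadResponse a q x ≠ 0) :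
    ∃ r > 0, ∃ C > 0, ∀ (ω t : ℝ) (w h : ℝ → ℝ), IsProfile a q k ω w h t →
      (∀ x, |w x - quadResponse a q x| ≤ r) → (∀ x, |h x| ≤ r) →
      (ω * (∫ x, decaySol a q x ^ 2 * quadResponse a q x) < 0 → 0 < t) ∧ |t| ≤ C * |ω| := by
  obtain ⟨B, hB, hWB⟩ := exists_quadResponse_bound (η := 0) ha hq le_rfl (by positivity)
    (by positivity)
  simp only [zero_mul, neg_zero, exp_zero, mul_one] at hWB
  set Q := ∫ x, decaySol a q x ^ 2 * quadResponse a q x with hQdef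
  set P := ∫ x, decaySol a q x * decaySol a q x with hPdef
  have hP : 0 < P := integral_decaySol_sq_pos ha hq
  set Φ : ℝ := 2 ^ q with hΦ
  have hΦ0 : 0 < Φ := by positivity
  have hφb : ∀ x, |decaySol a q x| ≤ Φ := decaySol_bound ha hq
  have hcφ := continuous_decaySol a q
  have hcW := continuous_quadResponse a q
  set I := ∫ x, |decaySol a q x| with hI
  have hφi : Integrable fun x => |decaySol a q x| := by
    have := (integrable_decaySol_mul (f := fun _ => 1) (M := 1) ha hq continuous_const (by simp)).abs
    simpa using this
  have hI0 : 0 ≤ I := integral_nonneg fun x => abs_nonneg _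
  have hQ0 : 0 < |Q| := abs_pos.2 hQ
  have key : ∀ (f : ℝ → ℝ) (M : ℝ), Continuous f → (∀ x, |f x| ≤ M) →
      |∫ x, decaySol a q x * f x| ≤ I * M := fun f M hf hM => by
    rw [hI, ← integral_mul_const, ← norm_eq_abs]
    refine norm_integral_le_of_norm_le (hφi.mul_const _) (Eventually.of_forall fun x => ?_)
    rw [norm_mul, norm_eq_abs, norm_eq_abs]
    exact mul_le_mul_of_nonneg_left (hM x) (abs_nonneg _)
  -- a radius for which both integrals keep at least half of their leading values
  set r := min 1 (min (P / (2 * (I + 1))) (|Q| / (2 * (I + 1) * (Φ + 1 + B)))) with hr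
  have hr0 : 0 < r := by positivity
  have hr1 : r ≤ 1 := min_le_left _ _
  have hrP : I * r ≤ P / 2 := by
    have : r ≤ P / (2 * (I + 1)) := (min_le_right _ _).trans (min_le_left _ _)
    rw [le_div_iff₀ (by positivity)] at this
    nlinarith
  have hrQ : I * (r * (Φ + 1 + B)) ≤ |Q| / 2 := by
    have : r ≤ |Q| / (2 * (I + 1) * (Φ + 1 + B)) := (min_le_right _ _).trans (min_le_right _ _)
    rw [le_div_iff₀ (by positivity)] at this
    have h2 : 0 ≤ r * (Φ + 1 + B) := by positivity
    nlinarith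
  refine ⟨r, hr0, 3 * P / (k * |Q|), by positivity, fun ω t w h hp hw hh => ?_⟩
  have hcw := hp.cont_w
  have hch := hp.cont_h
  have hwb : ∀ x, |w x| ≤ B + 1 := fun x => by
    have h1 := abs_add_le (w x - quadResponse a q x) (quadResponse a q x)
    rw [sub_add_cancel] at h1
    linarith [hw x, hWB x]
  have hghb : ∀ x, |decaySol a q x + h x| ≤ Φ + 1 := fun x =>
    (abs_add_le _ _).trans (by linarith [hφb x, hh x])
  set P' := ∫ x, decaySol a q x * (decaySol a q x + h x) with hP'
  set Q' := ∫ x, decaySol a q x * (w x * (decaySol a q x + h x)) with hQ'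
  have i1 : Integrable fun x => decaySol a q x * (decaySol a q x + h x) :=
    integrable_decaySol_mul ha hq (by fun_prop) hghb
  have i2 : Integrable fun x => decaySol a q x * (w x * (decaySol a q x + h x)) :=
    integrable_decaySol_mul (M := (B + 1) * (Φ + 1)) ha hq (by fun_prop) fun x => by
      rw [abs_mul]; exact mul_le_mul (hwb x) (hghb x) (abs_nonneg _) (by positivity)
  have i3 : Integrable fun x => decaySol a q x * decaySol a q x :=
    integrable_decaySol_mul ha hq hcφ hφb
  have i4 : Integrable fun x => decaySol a q x * (decaySol a q x * quadResponse a q x) :=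
    integrable_decaySol_mul (M := Φ * B) ha hq (by fun_prop) fun x => by
      rw [abs_mul]; exact mul_le_mul (hφb x) (hWB x) (abs_nonneg _) (by positivity)
  have hPP : |P' - P| ≤ P / 2 := by
    rw [hP', hPdef, ← integral_sub i1 i3]
    have e : (fun x => decaySol a q x * (decaySol a q x + h x) - decaySol a q x * decaySol a q x) =
        fun x => decaySol a q x * h x := by funext x; ring
    rw [e]
    exact (key h r hch hh).trans hrP
  have hQQ : |Q' - Q| ≤ |Q| / 2 := by
    have e0 : Q = ∫ x, decaySol a q x * (decaySol a q x * quadResponse a q x) := by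
      rw [hQdef]; congr 1; funext x; ring
    rw [e0, hQ', ← integral_sub i2 i4, ← e0]
    have e : (fun x => decaySol a q x * (w x * (decaySol a q x + h x)) -
        decaySol a q x * (decaySol a q x * quadResponse a q x)) = fun x => decaySol a q x *
          ((w x - quadResponse a q x) * (decaySol a q x + h x) + quadResponse a q x * h x) := by
      funext x; ring
    rw [e]
    refine (key _ (r * (Φ + 1 + B)) (by fun_prop) fun x => ?_).trans hrQ
    refine (abs_add_le _ _).trans ?_
    rw [abs_mul, abs_mul]
    have h1 := mul_le_mul (hw x) (hghb x) (abs_nonneg _) hr0.le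
    have h2 := mul_le_mul (hWB x) (hh x) (abs_nonneg _) hB.le
    linarith
  -- the solvability condition, a linear relation between `ω` and `t`
  have hrel : ω * P' + k * t * Q' = 0 := by
    rw [hP', hQ', ← integral_const_mul, ← integral_const_mul, ← integral_add (i1.const_mul _)
      (i2.const_mul _), ← hp.orth]
    congr 1; funext x; ring
  rw [abs_le] at hPP
  have hP'0 : 0 < P' := by linarith
  have hQ'Q : 0 < Q' * Q := by
    rw [abs_le] at hQQ
    rcases lt_or_gt_of_ne hQ with hneg | hpos
    · rw [abs_of_neg hneg] at hQQ
      exact mul_pos_of_neg_of_neg (by linarith) hneg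
    · rw [abs_of_pos hpos] at hQQ
      exact mul_pos (by linarith) hpos
  constructor
  · intro hω
    have h1 : t * (k * (Q' * Q)) = -(ω * Q) * P' := by linear_combination Q * hrel
    have h2 : 0 < t * (k * (Q' * Q)) := by
      rw [h1]; exact mul_pos (by linarith) hP'0
    exact (mul_pos_iff_of_pos_right (by positivity)).1 h2
  · have hQ'b : |Q| / 2 ≤ |Q'| := by
      have := abs_sub_abs_le_abs_sub Q Q'
      rw [abs_sub_comm] at this
      linarith
    have h1 : |t| * (k * |Q'|) = |ω| * P' := by
      have : t * (k * Q') = -(ω * P') := by linear_combination hrel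
      have h2 := congrArg abs this
      rwa [abs_mul, abs_mul, abs_of_pos hk, abs_neg, abs_mul, abs_of_pos hP'0] at h2
    rw [div_mul_eq_mul_div, le_div_iff₀ (by positivity)]
    have h3 : |t| * (k * (|Q| / 2)) ≤ |t| * (k * |Q'|) := by gcongr
    have h4 : |ω| * P' ≤ |ω| * (3 * P / 2) := mul_le_mul_of_nonneg_left (by linarith) (abs_nonneg _)
    linarith

/-! ### From small solutions to profiles -/

lemma eventually_le_of_continuous {F : ℝ → ℝ} (hF : Continuous F) (h0 : F 0 = 0) {d : ℝ}
    (hd : 0 < d) : ∀ᶠ ε in 𝓝[>] (0 : ℝ), F ε ≤ d := by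
  have : ∀ᶠ ε in 𝓝 (0 : ℝ), F ε < d :=
    hF.continuousAt.eventually_lt continuousAt_const (by rw [h0]; exact hd)
  exact (this.filter_mono nhdsWithin_le_nhds).mono fun _ h => h.le

/-- A small classical solution of the coupled system, written as `(z, b)` around the soliton, is a rescaled
profile close to the base point. The scale is `s = b' 0 / φ' 0`: the linear estimates give
`sup |z| = O (s²)` and `sup |b - s φ| = o (s)`. The factor `2` in the bounds is the constant of the
Sobolev embedding `MemH2.exists_rep`. -/
lemma exists_profile_of_small {a q k r : ℝ} (ha : 0 < a) (hq : 0 < q) (hk : 0 < k) (hr : 0 < r) :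
    ∃ ε > 0, ∀ (ω : ℝ) (z z₁ b b₁ : ℝ → ℝ), |ω| < ε → (∀ x, HasDerivAt z (z₁ x) x) →
      (∀ x, HasDerivAt z₁ (potential a 2 x * z x - (1 / 2 * z x ^ 2 + b x ^ 2)) x) →
      (∀ x, HasDerivAt b (b₁ x) x) →
      (∀ x, HasDerivAt b₁ (potential a q x * b x - (ω + k * z x) * b x) x) →
      (∀ x, z (-x) = z x) → (∀ x, b (-x) = -b x) → z₁ 0 = 0 → (∃ x, b x ≠ 0) →
      (∀ x, |z x| ≤ 2 * ε) → (∀ x, |z₁ x| ≤ 2 * ε) → (∀ x, |b x| ≤ 2 * ε) →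
      (∀ x, |b₁ x| ≤ 2 * ε) →
      ∃ (s : ℝ) (w h : ℝ → ℝ), IsProfile a q k ω w h (s ^ 2) ∧
        (∀ x, |w x - quadResponse a q x| ≤ r) ∧ (∀ x, |h x| ≤ r) ∧ s ^ 2 ≤ r ∧
        (∀ x, z x = s ^ 2 * w x) ∧ ∀ x, b x = s * (decaySol a q x + h x) := by
  obtain ⟨C₁, hC₁, hb₁⟩ := exists_greenFn_bound (η := 0) ha two_pos le_rfl (by positivity)
  obtain ⟨C₂, hC₂, hb₂⟩ := exists_greenFn_bound (η := 0) ha hq le_rfl (by positivity)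
  simp only [zero_mul, neg_zero, exp_zero, mul_one] at hb₁ hb₂
  obtain ⟨Φ, hΦdef⟩ : ∃ Φ : ℝ, Φ = 2 ^ q + a * (q + 1) * 2 ^ q := ⟨_, rfl⟩
  have hΦ0 : 0 < Φ := by rw [hΦdef]; positivity
  have hφb : ∀ x, |decaySol a q x| ≤ Φ := fun x => (decaySol_bound ha hq x).trans (by
    rw [hΦdef]; have : 0 < a * (q + 1) * 2 ^ q := by positivity
    linarith)
  have hφb₁ : ∀ x, |decaySolDeriv a q x| ≤ Φ := fun x => (abs_decaySolDeriv_le ha hq x).trans (by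
    have h1 : a * (q + 1) * 2 ^ q * exp (-(a * q * |x|)) ≤ a * (q + 1) * 2 ^ q :=
      mul_le_of_le_one_right (by positivity) (exp_neg_mul_abs_le_one (by positivity) x)
    have h2 : (0 : ℝ) < 2 ^ q := by positivity
    rw [hΦdef]; linarith)
  have hcφ := continuous_decaySol a q
  obtain ⟨Mw, hMw⟩ : ∃ Mw : ℝ, Mw = 2 * C₁ * (2 * Φ) ^ 2 := ⟨_, rfl⟩
  -- the bound for `h` as a function of the smallness parameter
  obtain ⟨H, hH⟩ : ∃ H : ℝ → ℝ, H = fun ε => C₂ * (ε + k * (2 * ε)) * (2 * Φ) := ⟨_, rfl⟩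
  have hHc : Continuous H := by rw [hH]; fun_prop
  have hH0 : H 0 = 0 := by rw [hH]; simp
  have hev : ∀ᶠ ε in 𝓝[>] (0 : ℝ), 0 < ε ∧ C₁ * ε ≤ 1 / 2 ∧ C₂ * (ε + k * (2 * ε)) ≤ 1 / 2 ∧
      H ε ≤ r ∧ H ε ≤ 1 ∧
      C₁ * ((2 * ε / a) ^ 2 / 2 * Mw ^ 2 + (2 * Φ + 1) * H ε) ≤ r ∧ (2 * ε / a) ^ 2 ≤ r := by
    have hpos : ∀ᶠ ε in 𝓝[>] (0 : ℝ), 0 < ε := eventually_mem_nhdsWithin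
    refine hpos.and (.and ?_ (.and ?_ (.and ?_ (.and ?_ (.and ?_ ?_)))))
    · exact eventually_le_of_continuous (by fun_prop) (by simp) (by norm_num)
    · exact eventually_le_of_continuous (by fun_prop) (by simp) (by norm_num)
    · exact eventually_le_of_continuous hHc hH0 hr
    · exact eventually_le_of_continuous hHc hH0 one_pos
    · exact eventually_le_of_continuous (by fun_prop) (by simp [hH0]) hr
    · exact eventually_le_of_continuous (by fun_prop) (by simp) hr
  obtain ⟨ε, hε, c1, c2, c3, c4, c5, c6⟩ := hev.exists
  refine ⟨ε, hε, fun ω z z₁ b b₁ hω dz dz₁ db db₁ hze hbo hz10 hb0 bz bz₁ bb bb₁ => ?_⟩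
  have hcz : Continuous z := continuous_iff_continuousAt.2 fun x => (dz x).continuousAt
  have hcb : Continuous b := continuous_iff_continuousAt.2 fun x => (db x).continuousAt
  obtain ⟨Z, hZ, -⟩ := exists_boundedContinuous (η := 0) (M := 2 * ε) hcz (by simpa using bz)
  obtain ⟨Bf, hBf, -⟩ := exists_boundedContinuous (η := 0) (M := 2 * ε) hcb (by simpa using bb)
  simp only [expWeight_zero, one_mul] at hZ hBf
  have nz : ∀ x, |z x| ≤ ‖Z‖ := fun x => by rw [← hZ]; exact abs_apply_le Z x
  have nb : ∀ x, |b x| ≤ ‖Bf‖ := fun x => by rw [← hBf]; exact abs_apply_le Bf x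
  have hZle : ∀ K, 0 ≤ K → (∀ x, |z x| ≤ K) → ‖Z‖ ≤ K := fun K hK h =>
    (BoundedContinuousFunction.norm_le hK).2 fun x => by rw [hZ]; exact h x
  have hBle : ∀ K, 0 ≤ K → (∀ x, |b x| ≤ K) → ‖Bf‖ ≤ K := fun K hK h =>
    (BoundedContinuousFunction.norm_le hK).2 fun x => by rw [hBf]; exact h x
  have hZε : ‖Z‖ ≤ 2 * ε := hZle _ (by positivity) bz
  have hZ0 := norm_nonneg Z
  have hB0 := norm_nonneg Bf
  -- the equation for `z`
  set f₁ : ℝ → ℝ := fun x => 1 / 2 * z x ^ 2 + b x ^ 2 with hf₁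
  have hf₁c : Continuous f₁ := by rw [hf₁]; fun_prop
  have hf₁b : ∀ x, |f₁ x| ≤ ε * ‖Z‖ + ‖Bf‖ ^ 2 := fun x => by
    have h1 : z x ^ 2 ≤ ‖Z‖ ^ 2 := by
      rw [← sq_abs (z x)]; exact pow_le_pow_left₀ (abs_nonneg _) (nz x) 2
    have h2 : b x ^ 2 ≤ ‖Bf‖ ^ 2 := by
      rw [← sq_abs (b x)]; exact pow_le_pow_left₀ (abs_nonneg _) (nb x) 2
    rw [hf₁, abs_of_nonneg (by positivity)]
    nlinarith
  obtain ⟨ho₁, hz_eq⟩ := eq_greenFn_of_bounded ha two_pos hf₁c hf₁b dz dz₁ bz bz₁ hz10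
  -- the term quadratic in `z` is absorbed on the left
  have hZB : ‖Z‖ ≤ 2 * C₁ * ‖Bf‖ ^ 2 := by
    have h1 : ‖Z‖ ≤ C₁ * (ε * ‖Z‖ + ‖Bf‖ ^ 2) := hZle _ (by positivity) fun x => by
      rw [hz_eq]; exact (hb₁ f₁ _ hf₁c hf₁b ho₁ x).1
    have h2 : C₁ * ε * ‖Z‖ ≤ 1 / 2 * ‖Z‖ := mul_le_mul_of_nonneg_right c1 hZ0
    nlinarith
  -- the equation for `b - s φ`
  set s := b₁ 0 / a with hs
  set f₂ : ℝ → ℝ := fun x => (ω + k * z x) * b x with hf₂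
  have hf₂c : Continuous f₂ := by rw [hf₂]; fun_prop
  have hf₂b : ∀ x, |f₂ x| ≤ (ε + k * (2 * ε)) * ‖Bf‖ := fun x => by
    rw [hf₂]; simp only
    rw [abs_mul]
    refine mul_le_mul ((abs_add_le _ _).trans ?_) (nb x) (abs_nonneg _) (by positivity)
    rw [abs_mul, abs_of_pos hk]
    have := mul_le_mul_of_nonneg_left (bz x) hk.le
    linarith
  set N := 2 * ε + |s| * Φ with hN
  have hbound : ∀ u v : ℝ, |u| ≤ 2 * ε → |v| ≤ Φ → |u - s * v| ≤ N := fun u v hu hv => by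
    refine (abs_sub _ _).trans ?_
    rw [abs_mul]
    have := mul_le_mul_of_nonneg_left hv (abs_nonneg s)
    linarith
  obtain ⟨ho₂, hb_eq⟩ := eq_greenFn_of_bounded (N := N) (u := fun x => b x - s * decaySol a q x)
    (u₁ := fun x => b₁ x - s * decaySolDeriv a q x) ha hq hf₂c hf₂b
    (fun x => (db x).sub ((hasDerivAt_decaySol a q x).const_mul s))
    (fun x => ((db₁ x).sub ((hasDerivAt_decaySolDeriv a q x).const_mul s)).congr_deriv (by
      rw [hf₂]; ring))
    (fun x => hbound _ _ (bb x) (hφb x)) (fun x => hbound _ _ (bb₁ x) (hφb₁ x))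
    (by rw [decaySolDeriv_zero, hs]; field_simp; ring)
  have hbφ : ∀ x, |b x - s * decaySol a q x| ≤ C₂ * ((ε + k * (2 * ε)) * ‖Bf‖) := fun x => by
    rw [hb_eq]; exact (hb₂ f₂ _ hf₂c hf₂b ho₂ x).1
  have hBs : ‖Bf‖ ≤ 2 * Φ * |s| := by
    have h1 : ‖Bf‖ ≤ C₂ * ((ε + k * (2 * ε)) * ‖Bf‖) + |s| * Φ :=
      hBle _ (by positivity) fun x => by
        have e : b x = (b x - s * decaySol a q x) + s * decaySol a q x := by ring
        rw [e]
        refine (abs_add_le _ _).trans ?_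
        rw [abs_mul s]
        exact add_le_add (hbφ x) (mul_le_mul_of_nonneg_left (hφb x) (abs_nonneg s))
    have h2 := mul_le_mul_of_nonneg_right c2 hB0
    linarith
  -- the whole of `b` is controlled by `s`, so `b` would vanish with it
  have hs0 : s ≠ 0 := by
    intro h
    obtain ⟨x, hx⟩ := hb0
    apply hx
    rw [h, abs_zero, mul_zero] at hBs
    exact abs_nonpos_iff.1 ((nb x).trans hBs)
  have hsp : 0 < |s| := abs_pos.2 hs0
  have hs2 : s ^ 2 ≤ (2 * ε / a) ^ 2 := by
    rw [← sq_abs s, hs, abs_div, abs_of_pos ha]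
    have := bb₁ 0
    gcongr
  set w : ℝ → ℝ := fun x => (s ^ 2)⁻¹ * z x with hw
  set h : ℝ → ℝ := fun x => s⁻¹ * (b x - s * decaySol a q x) with hh
  have hzw : ∀ x, z x = s ^ 2 * w x := fun x => by simp only [hw]; field_simp
  have hbh : ∀ x, b x = s * (decaySol a q x + h x) := fun x => by
    simp only [hh]; field_simp; ring
  have hwb : ∀ x, |w x| ≤ Mw := fun x => by
    rw [hw]; simp only
    rw [abs_mul, abs_of_pos (by positivity), inv_mul_le_iff₀ (by positivity), hMw]
    have h1 : ‖Bf‖ ^ 2 ≤ (2 * Φ * |s|) ^ 2 := pow_le_pow_left₀ hB0 hBs 2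
    have h2 : (2 * Φ * |s|) ^ 2 = s ^ 2 * (2 * Φ) ^ 2 := by rw [mul_pow, sq_abs]; ring
    rw [h2] at h1
    have h3 := mul_le_mul_of_nonneg_left h1 (by positivity : 0 ≤ 2 * C₁)
    linarith [nz x]
  have hhb : ∀ x, |h x| ≤ H ε := fun x => by
    rw [hh]; simp only
    rw [abs_mul, abs_inv, inv_mul_le_iff₀ hsp, hH]
    refine (hbφ x).trans ?_
    have h1 := mul_le_mul_of_nonneg_left hBs (by positivity : 0 ≤ C₂ * (ε + k * (2 * ε)))
    simp only
    linarith
  have hcw : Continuous w := by rw [hw]; fun_prop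
  have hch : Continuous h := by rw [hh]; fun_prop
  have hHε0 : 0 ≤ H ε := (abs_nonneg _).trans (hhb 0)
  have e₁ : (fun y => (s ^ 2)⁻¹ * f₁ y) =
      fun y => s ^ 2 / 2 * w y ^ 2 + (decaySol a q y + h y) ^ 2 := by
    funext y
    simp only [hf₁]
    rw [hzw y, hbh y]; field_simp
  have e₂ : (fun y => s⁻¹ * f₂ y) =
      fun y => (ω + k * s ^ 2 * w y) * (decaySol a q y + h y) := by
    funext y
    simp only [hf₂]
    rw [hzw y, hbh y]; field_simp
  have hp : IsProfile a q k ω w h (s ^ 2) := by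
    refine ⟨hcw, hch, fun x => ?_, fun x => ?_, fun x => ?_, ?_, fun x => ?_⟩
    · simp only [hw, hze]
    · simp only [hh, hbo, decaySol_neg]; ring
    · rw [← e₁, greenFn_const_mul, ← hz_eq]
    · rw [← mul_zero s⁻¹, ← ho₂, ← integral_const_mul]
      congr 1; funext x
      rw [← congrFun e₂ x]; ring
    · rw [← e₂, greenFn_const_mul, ← hb_eq]
  refine ⟨s, w, h, hp, fun x => ?_, fun x => (hhb x).trans c3, hs2.trans c6, hzw, hbh⟩
  -- the remainder in the first equation
  set e : ℝ → ℝ := fun y => s ^ 2 / 2 * w y ^ 2 + (2 * decaySol a q y + h y) * h y with he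
  have hec : Continuous e := by rw [he]; fun_prop
  have heb : ∀ y, |e y| ≤ (2 * ε / a) ^ 2 / 2 * Mw ^ 2 + (2 * Φ + 1) * H ε := fun y => by
    rw [he]
    refine (abs_add_le _ _).trans (add_le_add ?_ ?_)
    · rw [abs_mul, abs_of_nonneg (by positivity), abs_pow]
      have := hwb y
      gcongr
    · rw [abs_mul]
      refine mul_le_mul ((abs_add_le _ _).trans ?_) (hhb y) (abs_nonneg _) (by positivity)
      rw [abs_mul, abs_of_pos (two_pos (α := ℝ))]
      linarith [hφb y, hhb y]
  have heo : ∫ y, decaySol a 2 y * e y = 0 := integral_decaySol_mul_even a 2 fun y => by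
    simp only [he, hp.even, hp.odd, decaySol_neg]; ring
  have hsplit : w x = quadResponse a q x + greenFn a 2 e x := by
    have hsq : ∀ y, |decaySol a q y ^ 2| ≤ Φ ^ 2 := fun y => by
      rw [abs_pow]; exact pow_le_pow_left₀ (abs_nonneg _) (hφb y) 2
    rw [quadResponse, ← greenFn_add (f := fun y => decaySol a q y ^ 2) ha two_pos (hcφ.pow 2) hec hsq
      heb, hp.eq_w]
    congr 1
    funext y; simp only [he]; ring
  rw [hsplit, add_sub_cancel_left]
  exact (hb₁ e _ hec heb heo x).1.trans c5

/-! ### Regularity of `H²` solutions -/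

lemma comp_neg_of_ae_eq {f u : ℝ → ℝ} {σ : ℝ} (h : f =ᵐ[volume] u) (hu : Continuous u)
    (hσ : ∀ᵐ x, f (-x) = σ * f x) (x : ℝ) : u (-x) = σ * u x := by
  have h' : (fun x => f (-x)) =ᵐ[volume] fun x => u (-x) :=
    (Measure.measurePreserving_neg (volume : Measure ℝ)).quasiMeasurePreserving.ae_eq_comp h
  have h'' : (fun x => u (-x)) =ᵐ[volume] fun x => σ * u x := by
    filter_upwards [h, h', hσ] with x a1 a2 a3
    rw [← a2, a3, a1]
  exact congrFun ((Continuous.ae_eq_iff_eq volume (hu.comp continuous_neg)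
    (continuous_const.mul hu)).1 h'') x

lemma hasDerivAt_of_primitive {u g G : ℝ → ℝ} (h : ∀ x, u x = u 0 + ∫ t in (0 : ℝ)..x, g t)
    (hg : g =ᵐ[volume] G) (hG : Continuous G) (x : ℝ) : HasDerivAt u (G x) x := by
  have e : u = fun x => u 0 + ∫ t in (0 : ℝ)..x, G t := by
    funext x
    rw [h x, intervalIntegral.integral_congr_ae (hg.mono fun t ht _ => ht)]
  rw [e]
  exact (hasDerivAt_integral_of_continuous hG x).const_add _

lemma deriv_zero_of_even {u : ℝ → ℝ} {d : ℝ} (hu : HasDerivAt u d 0) (he : ∀ x, u (-x) = u x) :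
    d = 0 := by
  have h1 : HasDerivAt u d (-(0 : ℝ)) := by rwa [neg_zero]
  have h2 := h1.comp (0 : ℝ) (hasDerivAt_neg (0 : ℝ))
  have e : u ∘ Neg.neg = u := funext he
  rw [show (u ∘ fun x => -x) = u from e] at h2
  have := h2.unique hu
  linarith

/-- A decay rate admissible for both equations. -/
lemma exists_rate {a q : ℝ} (ha : 0 < a) (hq : 0 < q) : ∃ η, 0 < η ∧ η < a * 2 ∧ η < a * q := by
  have h : 0 < min (a * 2) (a * q) := by positivity
  refine ⟨min (a * 2) (a * q) / 2, by positivity, ?_, ?_⟩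
  · have := min_le_left (a * 2) (a * q); linarith
  · have := min_le_right (a * 2) (a * q); linarith

/-- `quadResponse` is `L₁⁻¹ g̃²`. Uniqueness holds since an even solution has derivative zero at the
origin, which the kernel element `U₀'` of `L₁` does not. -/
lemma quadResponse_spec {c k : ℝ} (hc : 0 < c) (hk : 1 / 6 < k) :
    MemH2Even (quadResponse (sqrt c / 2) (expQ k)) ∧
      (∀ᵐ x, opL1 c (quadResponse (sqrt c / 2) (expQ k)) x = gTilde c k x ^ 2) ∧
      ∀ V : ℝ → ℝ, MemH2Even V → (∀ᵐ x, opL1 c V x = gTilde c k x ^ 2) →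
        V =ᵐ[volume] quadResponse (sqrt c / 2) (expQ k) := by
  have hq := expQ_pos hk
  simp only [gTilde_eq]
  set q := expQ k with hqdef
  set a := sqrt c / 2 with hadef
  have ha : 0 < a := by have := sqrt_pos.2 hc; positivity
  obtain ⟨η, hη, hη2, hηq⟩ := exists_rate ha hq
  set f : ℝ → ℝ := fun y => decaySol a q y ^ 2 with hf
  have hfc : Continuous f := (continuous_decaySol a q).pow 2
  have hfb := decaySol_sq_le ha hq hηq.le
  have hfo : ∫ x, decaySol a 2 x * f x = 0 := integral_decaySol_two_mul_sq a q
  have hfM : ∀ x, |f x| ≤ 2 ^ q * 2 ^ q := fun x => (hfb x).trans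
    (mul_le_of_le_one_right (by positivity) (exp_neg_mul_abs_le_one hη.le x))
  obtain ⟨C, hC, hb⟩ := exists_greenFn_decay ha two_pos hη.le hη2
  have hb := hb f _ hfc hfb hfo
  have hW : quadResponse a q = greenFn a 2 f := rfl
  have hVc := continuous_potential a 2
  have hWc := continuous_quadResponse a q
  have hcont : Continuous fun x => potential a 2 x * greenFn a 2 f x - f x := by
    rw [← hW]; fun_prop
  have d := hasDerivAt_greenFn a 2 hfc
  have d₁ := hasDerivAt_greenFnDeriv ha.ne' 2 hfc
  have hm := memH2_of_decay hη d d₁ hcont (fun x => (hb x).1) (fun x => (hb x).2.1)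
    (fun x => (hb x).2.2)
  refine ⟨⟨hm.1, Eventually.of_forall fun x => ?_⟩, ?_, fun V hV hVeq => ?_⟩
  · rw [hW, greenFn_neg ha two_pos hfc hfM hfo]
    simp only [hf, decaySol_neg, neg_sq]
  · filter_upwards [weakDeriv_weakDeriv_ae_eq_of_hasDerivAt d d₁ hcont] with x hx
    rw [opL1, hW, hx, hadef, potential_two hc.le, ← hadef]
    ring
  · obtain ⟨u, u₁, g, hVu, du, -, hu₁, hg, bu, bu₁⟩ := hV.1.exists_rep
    have hcu : Continuous u := continuous_iff_continuousAt.2 fun x => (du x).continuousAt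
    have hG : g =ᵐ[volume] fun x => potential a 2 x * u x - f x := by
      filter_upwards [hg, hVeq, hVu] with x a1 a2 a3
      rw [opL1, a1, a3] at a2
      rw [hadef, potential_two hc.le]
      linear_combination -a2
    have du₁ := hasDerivAt_of_primitive hu₁ hG (by fun_prop)
    have he : ∀ x, u (-x) = u x := fun x => by
      have := comp_neg_of_ae_eq (σ := 1) hVu hcu (by simpa using hV.2) x
      rwa [one_mul] at this
    have h0 := deriv_zero_of_even (du 0) he
    have := (eq_greenFn_of_bounded ha two_pos hfc hfM du du₁ bu bu₁ h0).2
    filter_upwards [hVu] with x hx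
    rw [hx, this, hW]

/-- A small `H²` solution with nonzero second component is almost everywhere a rescaled profile near the
base point: its differentiable representatives solve the equations classically, since the right-hand
sides are continuous. -/
lemma exists_profile_of_solution {c k r : ℝ} (hc : 0 < c) (hk : 1 / 6 < k) (hr : 0 < r) :
    ∃ ε > 0, ∀ (ω : ℝ) (V B : ℝ → ℝ), |ω| < ε → MemH2Even V → MemH2Odd B →
      SolvesSystem c k 1 (omegaC c k + ω) V B → ¬ B =ᵐ[volume] 0 →
      h2Norm (fun x => V x - soliton c x) < ε → h2Norm B < ε →
      ∃ (s : ℝ) (w h : ℝ → ℝ), IsProfile (sqrt c / 2) (expQ k) k ω w h (s ^ 2) ∧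
        (∀ x, |w x - quadResponse (sqrt c / 2) (expQ k) x| ≤ r) ∧ (∀ x, |h x| ≤ r) ∧ s ^ 2 ≤ r ∧
        (V =ᵐ[volume] fun x => soliton c x + s ^ 2 * w x) ∧
        B =ᵐ[volume] fun x => s * (gTilde c k x + h x) := by
  have hq := expQ_pos hk
  have hk0 : 0 < k := by linarith
  simp only [gTilde_eq]
  set q := expQ k with hqdef
  set a := sqrt c / 2 with hadef
  have ha : 0 < a := by have := sqrt_pos.2 hc; positivity
  obtain ⟨ε, hε, hsmall⟩ := exists_profile_of_small ha hq hk0 hr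
  refine ⟨ε, hε, fun ω V B hω hV hB hsol hB0 hVn hBn => ?_⟩
  obtain ⟨hmz, hzw⟩ := hV.1.weakDeriv_weakDeriv_sub (memH2_soliton hc)
  obtain ⟨z, z₁, gz, hz, dz, -, hz₁, hgz, bz, bz₁⟩ := hmz.exists_rep
  obtain ⟨b, b₁, gb, hb, db, -, hb₁, hgb, bb, bb₁⟩ := hB.1.exists_rep
  have hcz : Continuous z := continuous_iff_continuousAt.2 fun x => (dz x).continuousAt
  have hcb : Continuous b := continuous_iff_continuousAt.2 fun x => (db x).continuousAt
  have hV2 := continuous_potential a 2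
  have hVq := continuous_potential a q
  have hS := weakDeriv_weakDeriv_ae_eq_of_hasDerivAt (hasDerivAt_soliton c)
    (hasDerivAt_solitonDeriv hc.le) (by have := continuous_soliton c; fun_prop)
  have hGz : gz =ᵐ[volume] fun x => potential a 2 x * z x - (1 / 2 * z x ^ 2 + b x ^ 2) := by
    filter_upwards [hgz, hzw, hS, hsol.1, hz, hb] with x a1 a2 a3 a4 a5 a6
    rw [← a1, a2, a3, ← a5, ← a6, hadef, potential_two hc.le]
    linear_combination a4
  have hGb : gb =ᵐ[volume] fun x => potential a q x * b x - (ω + k * z x) * b x := by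
    filter_upwards [hgb, hsol.2, hz, hb] with x a1 a2 a3 a4
    rw [← a1, ← a3, ← a4, hadef, hqdef, potential_expQ hc.le hk]
    linear_combination a2
  have dz₁ := hasDerivAt_of_primitive hz₁ hGz (by fun_prop)
  have db₁ := hasDerivAt_of_primitive hb₁ hGb (by fun_prop)
  have hze : ∀ x, z (-x) = z x := fun x => by
    have := comp_neg_of_ae_eq (σ := 1) hz hcz (by
      filter_upwards [hV.2] with x hx
      rw [hx, soliton_neg, one_mul]) x
    rwa [one_mul] at this
  have hbo : ∀ x, b (-x) = -b x := fun x => by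
    have := comp_neg_of_ae_eq (σ := -1) hb hcb (by simpa using hB.2) x
    rwa [neg_one_mul] at this
  have hb0 : ∃ x, b x ≠ 0 := by
    by_contra hcon
    push Not at hcon
    apply hB0
    filter_upwards [hb] with x hx
    rw [hx, hcon]; rfl
  obtain ⟨s, w, h, hp, hw, hh, hs, hzw', hbh⟩ := hsmall ω z z₁ b b₁ hω dz dz₁ db db₁ hze hbo
    (deriv_zero_of_even (dz 0) hze) hb0 (fun x => (bz x).trans (by linarith))
    (fun x => (bz₁ x).trans (by linarith)) (fun x => (bb x).trans (by linarith))
    (fun x => (bb₁ x).trans (by linarith))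
  refine ⟨s, w, h, hp, hw, hh, hs, ?_, ?_⟩
  · filter_upwards [hz] with x hx
    rw [← hzw', ← hx]; ring
  · filter_upwards [hb] with x hx
    rw [hx, hbh]

/-- The normalisation `h' 0 = 0` keeps the second component of a profile away from zero. -/
lemma IsProfile.exists_ne_zero {a q k ω t : ℝ} {w h : ℝ → ℝ} (ha : a ≠ 0)
    (hp : IsProfile a q k ω w h t) : ∃ x, decaySol a q x + h x ≠ 0 := by
  by_contra hcon
  push Not at hcon
  have hcw := hp.cont_w
  have hch := hp.cont_h
  have hcφ := continuous_decaySol a q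
  have hh := hasDerivAt_greenFn a q
    (f := fun y => (ω + k * t * w y) * (decaySol a q y + h y)) (by fun_prop) 0
  rw [← funext hp.eq_h, greenFnDeriv_zero] at hh
  have h1 := (hasDerivAt_decaySol a q 0).add hh
  have e : decaySol a q + h = fun _ => 0 := funext hcon
  rw [e, decaySolDeriv_zero, add_zero] at h1
  exact ha (h1.unique (hasDerivAt_const _ _))

end

end KdVLS

theorem mainTheorem6 (c k : ℝ) (hc : 0 < c) (hk : 1 / 6 < k) :
    -- `W` is `L₁⁻¹ g̃²`: the unique even `H²` solution of `L₁ W = g̃²`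
    ∃ W : ℝ → ℝ,
      (KdVLS.MemH2Even W ∧ (∀ᵐ x, KdVLS.opL1 c W x = KdVLS.gTilde c k x ^ 2) ∧
        ∀ V : ℝ → ℝ, KdVLS.MemH2Even V → (∀ᵐ x, KdVLS.opL1 c V x = KdVLS.gTilde c k x ^ 2) →
          V =ᵐ[volume] W) ∧
      ((∫ x, KdVLS.gTilde c k x ^ 2 * W x) ≠ 0 →
        ∃ δ C ε : ℝ, 0 < δ ∧ 0 < C ∧ 0 < ε ∧
          ∀ Ω : ℝ, |Ω - KdVLS.omegaC c k| < δ →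
            SignType.sign (Ω - KdVLS.omegaC c k) =
              -SignType.sign (∫ x, KdVLS.gTilde c k x ^ 2 * W x) →
            ∃ U A : ℝ → ℝ,
              -- existence of a coupled solution in the `ε`-neighbourhood, with the two bounds
              (KdVLS.MemH2Even U ∧ KdVLS.MemH2Odd A ∧ KdVLS.SolvesSystem c k 1 Ω U A ∧
                ¬ A =ᵐ[volume] 0 ∧
                KdVLS.h2Norm (fun x => U x - KdVLS.soliton c x) < ε ∧ KdVLS.h2Norm A < ε ∧
                KdVLS.h2Norm (fun x => U x - KdVLS.soliton c x) ≤ C * |Ω - KdVLS.omegaC c k| ∧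
                KdVLS.h2Norm A ≤ C * Real.sqrt |Ω - KdVLS.omegaC c k|) ∧
              -- uniqueness in the `ε`-neighbourhood, up to the symmetry `A ↦ -A`
              ∀ V B : ℝ → ℝ, KdVLS.MemH2Even V → KdVLS.MemH2Odd B →
                KdVLS.SolvesSystem c k 1 Ω V B → ¬ B =ᵐ[volume] 0 →
                KdVLS.h2Norm (fun x => V x - KdVLS.soliton c x) < ε → KdVLS.h2Norm B < ε →
                V =ᵐ[volume] U ∧ (B =ᵐ[volume] A ∨ B =ᵐ[volume] -A)) := by
  have hq := KdVLS.expQ_pos hk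
  have hk0 : 0 < k := by linarith
  have ha : 0 < Real.sqrt c / 2 := by have := Real.sqrt_pos.2 hc; positivity
  refine ⟨KdVLS.quadResponse (Real.sqrt c / 2) (KdVLS.expQ k), KdVLS.quadResponse_spec hc hk,
    fun hQ => ?_⟩
  have hQ' : ∫ x, KdVLS.decaySol (Real.sqrt c / 2) (KdVLS.expQ k) x ^ 2 *
      KdVLS.quadResponse (Real.sqrt c / 2) (KdVLS.expQ k) x ≠ 0 := hQ
  -- decay rate `η` for the construction; rate `0` for the uniqueness, where competitors are only known
  -- to be bounded
  obtain ⟨η, hη, hη2, hηq⟩ := KdVLS.exists_rate ha hq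
  obtain ⟨⟨r₀, hr₀, huniq⟩, -⟩ := KdVLS.profile_existsUnique (η := 0) ha hq hk0.ne' le_rfl
    (by positivity) (by positivity) hQ'
  simp only [zero_mul, neg_zero, Real.exp_zero, mul_one] at huniq
  obtain ⟨-, hex⟩ := KdVLS.profile_existsUnique ha hq hk0.ne' hη.le hη2 hηq hQ'
  obtain ⟨r₁, hr₁, C₁, hC₁, hamp⟩ := KdVLS.exists_amplitude_bound ha hq hk0 hQ'
  set r := min r₀ r₁ with hr
  have hr0 : 0 < r := lt_min hr₀ hr₁
  obtain ⟨δ₀, hδ₀, hex⟩ := hex r hr0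
  obtain ⟨ε, hε, hprof⟩ := KdVLS.exists_profile_of_solution hc hk hr0
  obtain ⟨B₀, hB₀, hWB⟩ := KdVLS.exists_quadResponse_bound ha hq hη.le hη2 hηq.le
  obtain ⟨C₂, hC₂, hsol⟩ := KdVLS.exists_solution_of_profile hc hk hη hη2 hηq
    (show 0 < B₀ + r by positivity)
  have hev : ∀ᶠ δ in nhdsWithin (0 : ℝ) (Set.Ioi 0), 0 < δ ∧ δ ≤ δ₀ ∧ δ ≤ r₀ ∧ δ ≤ ε ∧ δ ≤ 1 ∧
      C₁ * δ ≤ 1 ∧ C₂ * C₁ * δ ≤ ε / 2 ∧ C₂ * Real.sqrt C₁ * Real.sqrt δ ≤ ε / 2 := by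
    have hpos : ∀ᶠ δ in nhdsWithin (0 : ℝ) (Set.Ioi 0), 0 < δ := eventually_mem_nhdsWithin
    refine hpos.and (.and ?_ (.and ?_ (.and ?_ (.and ?_ (.and ?_ (.and ?_ ?_))))))
    · exact KdVLS.eventually_le_of_continuous continuous_id rfl hδ₀
    · exact KdVLS.eventually_le_of_continuous continuous_id rfl hr₀
    · exact KdVLS.eventually_le_of_continuous continuous_id rfl hε
    · exact KdVLS.eventually_le_of_continuous continuous_id rfl one_pos
    · exact KdVLS.eventually_le_of_continuous (by fun_prop) (by simp) one_pos
    · exact KdVLS.eventually_le_of_continuous (by fun_prop) (by simp) (half_pos hε)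
    · exact KdVLS.eventually_le_of_continuous (by fun_prop) (by simp) (half_pos hε)
  obtain ⟨δ, hδ, d₀, d₁, d₂, d₃, d₄, d₅, d₆⟩ := hev.exists
  refine ⟨δ, C₂ * C₁ + C₂ * Real.sqrt C₁, ε, hδ, by positivity, hε, fun Ω hΩ hsign => ?_⟩
  obtain ⟨ω, rfl⟩ : ∃ ω, Ω = KdVLS.omegaC c k + ω := ⟨Ω - KdVLS.omegaC c k, by ring⟩
  rw [add_sub_cancel_left] at hΩ hsign ⊢
  have hωQ : ω * (∫ x, KdVLS.gTilde c k x ^ 2 *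
      KdVLS.quadResponse (Real.sqrt c / 2) (KdVLS.expQ k) x) < 0 := by
    rcases lt_or_gt_of_ne hQ with hneg | hpos
    · rw [sign_neg hneg, neg_neg, sign_eq_one_iff] at hsign
      exact mul_neg_of_pos_of_neg hsign hneg
    · rw [sign_pos hpos, sign_eq_neg_one_iff] at hsign
      exact mul_neg_of_neg_of_pos hsign hpos
  obtain ⟨w, h, t, hp, hw, hh, ht⟩ := hex ω (hΩ.trans_le d₀)
  have hle : ∀ x : ℝ, r * Real.exp (-(η * |x|)) ≤ r := fun x =>
    mul_le_of_le_one_right hr0.le (KdVLS.exp_neg_mul_abs_le_one hη.le x)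
  have hwr : ∀ x, |w x - KdVLS.quadResponse (Real.sqrt c / 2) (KdVLS.expQ k) x| ≤ r :=
    fun x => (hw x).trans (hle x)
  have hhr : ∀ x, |h x| ≤ r := fun x => (hh x).trans (hle x)
  obtain ⟨htpos, htω⟩ := hamp ω t w h hp (fun x => (hwr x).trans (min_le_right _ _))
    fun x => (hhr x).trans (min_le_right _ _)
  have ht0 : 0 < t := htpos hωQ
  rw [abs_of_pos ht0] at htω ht
  -- the amplitude is `s = √t`
  obtain ⟨s, hs, rfl⟩ : ∃ s, 0 < s ∧ t = s ^ 2 := ⟨Real.sqrt t, Real.sqrt_pos.2 ht0,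
    (Real.sq_sqrt ht0.le).symm⟩
  have hs1 : s ^ 2 ≤ 1 := htω.trans ((mul_le_mul_of_nonneg_left hΩ.le hC₁.le).trans d₄)
  have hsω : s ≤ Real.sqrt C₁ * Real.sqrt |ω| := by
    rw [← Real.sqrt_mul hC₁.le]
    exact Real.le_sqrt_of_sq_le htω
  have hwN : ∀ x, |w x| ≤ (B₀ + r) * Real.exp (-(η * |x|)) := fun x => by
    have h1 := abs_add_le (w x - KdVLS.quadResponse (Real.sqrt c / 2) (KdVLS.expQ k) x)
      (KdVLS.quadResponse (Real.sqrt c / 2) (KdVLS.expQ k) x)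
    rw [sub_add_cancel] at h1
    linarith [hw x, hWB x]
  have hhN : ∀ x, |h x| ≤ (B₀ + r) * Real.exp (-(η * |x|)) := fun x => by
    have : 0 ≤ B₀ * Real.exp (-(η * |x|)) := by positivity
    linarith [hh x]
  obtain ⟨hU, hA, hsys, nU, nA⟩ := hsol ω s w h (hΩ.le.trans d₃) hs1 hp hwN hhN
  rw [abs_of_pos hs] at nA
  have hω0 : 0 ≤ |ω| := abs_nonneg ω
  have nU' := nU.trans (mul_le_mul_of_nonneg_left htω hC₂.le)
  have nA' := nA.trans (mul_le_mul_of_nonneg_left hsω hC₂.le)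
  have hsq0 := Real.sqrt_nonneg |ω|
  refine ⟨_, _, ⟨hU, hA, hsys, fun hA0 => ?_, ?_, ?_, ?_, ?_⟩, fun V B hV hB hVB hB0 hVn hBn => ?_⟩
  · obtain ⟨x, hx⟩ := hp.exists_ne_zero ha.ne'
    have hcA : Continuous fun x => s * (KdVLS.gTilde c k x + h x) :=
      continuous_const.mul ((KdVLS.continuous_decaySol _ _).add hp.cont_h)
    have := congrFun ((Continuous.ae_eq_iff_eq volume hcA continuous_zero).1 hA0) x
    exact (mul_ne_zero hs.ne' hx) this
  · have := mul_le_mul_of_nonneg_left hΩ.le (by positivity : 0 ≤ C₂ * C₁)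
    linarith
  · have h1 := mul_le_mul_of_nonneg_left (Real.sqrt_le_sqrt hΩ.le)
      (by positivity : 0 ≤ C₂ * Real.sqrt C₁)
    linarith
  · have : 0 ≤ C₂ * Real.sqrt C₁ * |ω| := by positivity
    linarith
  · have : 0 ≤ C₂ * C₁ * Real.sqrt |ω| := by positivity
    linarith
  · obtain ⟨s', w', h', hp', hw', hh', hs', hV', hB'⟩ :=
      hprof ω V B (hΩ.trans_le d₂) hV hB hVB hB0 hVn hBn
    have hr₀' : r ≤ r₀ := min_le_left _ _
    obtain ⟨rfl, rfl, hss⟩ := huniq ω (hΩ.trans_le d₁) w h w' h' (s ^ 2) (s' ^ 2) hp hp'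
      (fun x => (hwr x).trans hr₀') (fun x => (hhr x).trans hr₀')
      (by rw [abs_of_pos ht0]; exact ht.trans hr₀')
      (fun x => (hw' x).trans hr₀') (fun x => (hh' x).trans hr₀')
      (by rw [abs_of_nonneg (sq_nonneg _)]; exact hs'.trans hr₀')
    refine ⟨by rw [hss]; exact hV', ?_⟩
    rcases sq_eq_sq_iff_eq_or_eq_neg.1 hss.symm with rfl | rfl
    · exact Or.inl hB'
    · refine Or.inr ?_
      filter_upwards [hB'] with x hx
      rw [hx, Pi.neg_apply]; ring
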